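/- Let $n\ge 3$, $W=\mathbb{C}^n\setminus\{0\}$, let $f(z_1,\dots,z_n)=(\mu_1z_1,\dots,\mu_nz_n)$ with $0<|\mu_i|<1$ for all $i$, and let $X=W/\langle f\rangle$ be the corresponding Hopf manifold, with projection $\pi:W\to X$. For $b\in\mathbb{C}^*$ let $L_b$ be the holomorphic line bundle on $X$ obtained as the quotient of $W\times\mathbb{C}$ by $(z,v)\mapsto(f(z),bv)$. Let $\mathcal{F}$ be a nonsingular codimension-one holomorphic distribution on $X$ given by a morphism $\mathcal{N}^*_{\mathcal{F}}=L_b\to\Omega^1_X$, that is, by a holomorphic bundle map which is injective on every fibre; $\mathcal{F}_x\subset T_xX$ is the common kernel of the covectors in the image of $(L_b)_x$. We say that $\mathcal{F}$ is induced by a $1$-form $\omega$ on $W$ if $(d\pi_z)^{-1}(\mathcal{F}_{\pi(z)})=\ker\omega_z$ for every $z\in W$. Say that a family $(\mu_i)_{i\in S}$ has no non-trivial relation if $\prod_{i\in A}\mu_i^{r_i}=\prod_{j\in B}\mu_j^{r_j}$ with $A\cap B=\emptyset$, $A\cup B=S$ and $r_i\in\mathbb{N}=\{0,1,2,\dots\}$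 holds only if all $r_i=0$. Then the following holds. (i) If $X$ is classical, i.e. $\mu_1=\dots=\mu_n=\mu$, then $b^{-1}=\mu^m$ for some $m\in\mathbb{N}$, $m\ge 1$, and $\mathcal{F}$ is induced by a polynomial $1$-form $\omega=g_1dz_1+\dots+g_ndz_n$, where all $g_i$ are homogeneous polynomials of the same degree $m-1$ (the zero polynomial being allowed) without common zero in $W$, that is, $\{g_1=\dots=g_n=0\}\subseteq\{0\}$, with equality if $m\ge 2$. (ii) If $X$ is generic, i.e. $|\mu_1|\le\dots\le|\mu_n|$ and $(\mu_i)_{1\le i\le n}$ has no non-trivial relation, then for some $j\in\{1,\dots,n\}$ we have $b^{-1}=\mu_j$ and $\mathcal{F}$ is induced by $dz_j$. (iii) If $X$ is intermediary, i.e. for some $2\le r\le n-1$ we have $\mu_1=\dots=\mu_r$ and $(\mu_i)_{i\in\{1,r+1,\dots,n\}}$ has no non-trivial relation, then $b^{-1}\in\{\mu_1,\mu_{r+1},\dots,\mu_n\}$ and $\mathcal{F}$ is induced by a nonzero constant $1$-form $\sum_i c_i\,dz_i$. -/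

import Mathlib

open scoped Manifold ContDiff Topology

noncomputable section

namespace Hopf

/-! ### Quotients of complex manifolds by the cyclic group generated by an automorphism -/

section CyclicQuotient

variable {M : Type*} [TopologicalSpace M]

/-- Two points are equivalent iff they lie in the same orbit of the cyclic group `⟨f⟩`. -/
def cyclicSetoid (f : M ≃ₜ M) : Setoid M where
  r x y := ∃ k : ℤ, (f ^ k) x = y
  iseqv := by
    refine ⟨fun x => ⟨0, by simp⟩, ?_, ?_⟩
    · rintro x y ⟨k, rfl⟩
      refine ⟨-k, ?_⟩
      rw [← Homeomorph.mul_apply, ← zpow_add]; simp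
    · rintro x y z ⟨k, rfl⟩ ⟨l, rfl⟩
      refine ⟨l + k, ?_⟩
      rw [zpow_add, Homeomorph.mul_apply]

/-- The orbit space `M / ⟨f⟩`, with the quotient topology. -/
def CyclicQuotient (f : M ≃ₜ M) : Type _ := Quotient (cyclicSetoid f)

namespace CyclicQuotient

variable {f : M ≃ₜ M}

instance : TopologicalSpace (CyclicQuotient f) :=
  inferInstanceAs (TopologicalSpace (Quotient (cyclicSetoid f)))

/-- The quotient map `M → M / ⟨f⟩`. -/
def mk (f : M ≃ₜ M) (x : M) : CyclicQuotient f := Quotient.mk (cyclicSetoid f) x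

theorem mk_eq_mk {x y : M} : mk f x = mk f y ↔ ∃ k : ℤ, (f ^ k) x = y :=
  Quotient.eq (r := cyclicSetoid f)

theorem mk_surjective : Function.Surjective (mk f) := Quotient.mk_surjective

theorem continuous_mk : Continuous (mk f) := continuous_quotient_mk'

theorem mk_zpow (k : ℤ) (x : M) : mk f ((f ^ k) x) = mk f x :=
  (mk_eq_mk.2 ⟨k, rfl⟩).symm

theorem isOpenMap_mk : IsOpenMap (mk f) := by
  intro U hU
  have key : IsOpen (mk f ⁻¹' (mk f '' U)) := by
    have : mk f ⁻¹' (mk f '' U) = ⋃ k : ℤ, (f ^ k) '' U := by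
      ext y
      simp only [Set.mem_preimage, Set.mem_image, Set.mem_iUnion]
      constructor
      · rintro ⟨x, hx, hxy⟩
        obtain ⟨k, hk⟩ := mk_eq_mk.1 hxy
        exact ⟨k, x, hx, hk⟩
      · rintro ⟨k, x, hx, rfl⟩
        exact ⟨x, hx, (mk_zpow k x).symm⟩
    rw [this]
    exact isOpen_iUnion fun k => (f ^ k).isOpenMap U hU
  exact (isQuotientMap_quotient_mk'.isOpen_preimage).1 key

/-- `⟨f⟩` acts freely and discontinuously: every point has a neighbourhood disjoint from its
translates. -/
def Wandering (f : M ≃ₜ M) : Prop :=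
  ∀ x : M, ∃ U ∈ 𝓝 x, ∀ k : ℤ, ∀ y ∈ U, (f ^ k) y ∈ U → k = 0

theorem isLocalHomeomorph_mk (hf : Wandering f) : IsLocalHomeomorph (mk f) := by
  rw [isLocalHomeomorph_iff_isOpenEmbedding_restrict]
  intro x
  obtain ⟨U, hU, hfU⟩ := hf x
  refine ⟨interior U, interior_mem_nhds.2 hU, ?_⟩
  refine Topology.IsOpenEmbedding.of_continuous_injective_isOpenMap
    (continuous_mk.comp continuous_subtype_val) ?_
    (isOpenMap_mk.comp isOpen_interior.isOpenMap_subtype_val)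
  rintro ⟨y, hy⟩ ⟨z, hz⟩ hyz
  obtain ⟨k, hk⟩ := mk_eq_mk.1 hyz
  have h0 : k = 0 := hfU k y (interior_subset hy) (hk ▸ interior_subset hz)
  subst h0
  simpa using hk

variable {E : Type*} [NormedAddCommGroup E] [NormedSpace ℂ E] {H : Type*} [TopologicalSpace H]
  [ChartedSpace H M]

/-- The manifold structure on `M / ⟨f⟩`: charts are charts of `M` composed with local inverses of
the quotient map. -/
@[reducible]
def chartedSpace (H : Type*) [TopologicalSpace H] [ChartedSpace H M] (hf : Wandering f) :
    ChartedSpace H (CyclicQuotient f) :=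
  (isLocalHomeomorph_mk hf).chartedSpace mk_surjective

theorem contMDiff_zpow (I : ModelWithCorners ℂ E H)
    (h1 : ContMDiff I I ω f) (h2 : ContMDiff I I ω f.symm) (k : ℤ) :
    ContMDiff I I ω (f ^ k : M ≃ₜ M) := by
  have hn : ∀ (g : M ≃ₜ M), ContMDiff I I ω g → ∀ n : ℕ, ContMDiff I I ω (g ^ n : M ≃ₜ M) := by
    intro g hg n
    induction n with
    | zero => exact contMDiff_id
    | succ n ih =>
      rw [pow_succ]
      exact ih.comp hg
  obtain ⟨n, rfl | rfl⟩ := k.eq_nat_or_neg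
  · rw [zpow_natCast]; exact hn f h1 n
  · rw [zpow_neg, zpow_natCast, ← inv_pow]; exact hn f⁻¹ h2 n

theorem isManifold (I : ModelWithCorners ℂ E H) [IsManifold I ω M] (hf : Wandering f)
    (h1 : ContMDiff I I ω f) (h2 : ContMDiff I I ω f.symm) :
    let _ := chartedSpace H hf
    IsManifold I ω (CyclicQuotient f) := by
  let _ := chartedSpace H hf
  apply isManifold_of_contDiffOn
  rintro e e' ⟨q, rfl⟩ ⟨q', rfl⟩
  generalize mk_surjective.hasRightInverse.choose q = a
  generalize mk_surjective.hasRightInverse.choose q' = b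
  set ea := (isLocalHomeomorph_mk hf).localInverseAt a
  set eb := (isLocalHomeomorph_mk hf).localInverseAt b
  have hea : ∀ x, ea.symm x = mk f x := fun x => by simp [ea]
  have heb : ∀ x ∈ eb.source, mk f (eb x) = x := fun x hx =>
    (isLocalHomeomorph_mk hf).apply_localInverseAt_of_mem hx
  rintro p ⟨hp, y, rfl⟩
  simp only [Set.mem_preimage, ModelWithCorners.left_inv, OpenPartialHomeomorph.trans_source,
    OpenPartialHomeomorph.symm_source, Set.mem_inter_iff, OpenPartialHomeomorph.coe_trans_symm,
    Function.comp_apply, OpenPartialHomeomorph.trans_target, hea] at hp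
  obtain ⟨⟨hy1, -⟩, hy3, hy4⟩ := hp
  obtain ⟨k, hk⟩ := mk_eq_mk.1 (heb _ hy3).symm
  have hc1 : ContinuousAt (chartAt H a).symm y :=
    (chartAt H a).symm.continuousAt hy1
  have hc2 : ContinuousAt (fun y => (f ^ k) ((chartAt H a).symm y)) y :=
    (f ^ k).continuous.continuousAt.comp hc1
  have hsm : ContMDiffAt I I ω (fun y => chartAt H b ((f ^ k) ((chartAt H a).symm y))) y := by
    have h1' : ContMDiffAt I I ω (chartAt H a).symm y :=
      contMDiffOn_chart_symm.contMDiffAt ((chartAt H a).open_target.mem_nhds hy1)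
    have h2' : ContMDiffAt I I ω (chartAt H b) ((f ^ k) ((chartAt H a).symm y)) :=
      contMDiffOn_chart.contMDiffAt ((chartAt H b).open_source.mem_nhds (by rw [hk]; exact hy4))
    exact h2'.comp y ((contMDiff_zpow I h1 h2 k).contMDiffAt.comp y h1')
  have hloc : (fun y => chartAt H b ((f ^ k) ((chartAt H a).symm y))) =ᶠ[𝓝 y]
      fun y => chartAt H b (eb (mk f ((chartAt H a).symm y))) := by
    have m1 : ∀ᶠ z in 𝓝 y, mk f ((chartAt H a).symm z) ∈ eb.source :=
      (continuous_mk.continuousAt.comp hc1).preimage_mem_nhds (eb.open_source.mem_nhds hy3)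
    have m2 : ∀ᶠ z in 𝓝 y, (f ^ k) ((chartAt H a).symm z) ∈ eb.target :=
      hc2.preimage_mem_nhds (eb.open_target.mem_nhds (by rw [hk]; exact eb.map_source hy3))
    filter_upwards [m1, m2] with z hz1 hz2
    congr 1
    refine (isLocalHomeomorph_mk hf).injOn_localInverseAt_target hz2 (eb.map_source hz1) ?_
    rw [heb _ hz1, mk_zpow]
  have hfin := (hsm.congr_of_eventuallyEq hloc.symm)
  rw [contMDiffAt_iff] at hfin
  have h3 := hfin.2
  simp only [chartAt_self_eq, mfld_simps] at h3
  refine (h3.mono Set.inter_subset_right).congr ?_ ?_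
  · rintro _ ⟨-, z, rfl⟩
    simp [hea]
  · simp [hea]

theorem contMDiff_mk (I : ModelWithCorners ℂ E H) [IsManifold I ω M] (hf : Wandering f)
    (h1 : ContMDiff I I ω f) (h2 : ContMDiff I I ω f.symm) :
    let _ := chartedSpace H hf
    ContMDiff I I ω (mk f) := by
  intro _ x
  rw [contMDiffAt_iff_target]
  refine ⟨continuous_mk.continuousAt, ?_⟩
  have hch : chartAt H (mk f x) = ((isLocalHomeomorph_mk hf).localInverseAt
      (mk_surjective.hasRightInverse.choose (mk f x))).trans
      (chartAt H (mk_surjective.hasRightInverse.choose (mk f x))) := rfl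
  have hmem := mk_surjective.hasRightInverse.choose_spec (mk f x)
  revert hch hmem
  generalize mk_surjective.hasRightInverse.choose (mk f x) = b
  set eb := (isLocalHomeomorph_mk hf).localInverseAt b with hebdef
  intro hch hmem
  have heb : ∀ x ∈ eb.source, mk f (eb x) = x := fun x hx =>
    (isLocalHomeomorph_mk hf).apply_localInverseAt_of_mem hx
  have hsrc : mk f x ∈ eb.source := by
    rw [← hmem]; exact (isLocalHomeomorph_mk hf).apply_self_mem_localInverseAt_source
  have hebx : eb (mk f x) = b := by
    rw [← hmem]; exact (isLocalHomeomorph_mk hf).localInverseAt_apply_self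
  obtain ⟨k, hk⟩ := mk_eq_mk.1 hmem.symm
  have hloc : (fun z => extChartAt I b ((f ^ k) z)) =ᶠ[𝓝 x]
      extChartAt I (mk f x) ∘ mk f := by
    have m1 : ∀ᶠ z in 𝓝 x, mk f z ∈ eb.source :=
      continuous_mk.continuousAt.preimage_mem_nhds (eb.open_source.mem_nhds hsrc)
    have m2 : ∀ᶠ z in 𝓝 x, (f ^ k) z ∈ eb.target :=
      (f ^ k).continuous.continuousAt.preimage_mem_nhds
        (eb.open_target.mem_nhds (by rw [hk, ← hebx]; exact eb.map_source hsrc))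
    filter_upwards [m1, m2] with z hz1 hz2
    have : (f ^ k) z = eb (mk f z) := by
      refine (isLocalHomeomorph_mk hf).injOn_localInverseAt_target hz2 (eb.map_source hz1) ?_
      rw [heb _ hz1, mk_zpow]
    simp only [Function.comp_apply, extChartAt, OpenPartialHomeomorph.extend, hch, this]
    simp
  refine ContMDiffAt.congr_of_eventuallyEq ?_ hloc.symm
  have h3 : ContMDiffAt I 𝓘(ℂ, E) ω (extChartAt I b) ((f ^ k) x) := by
    rw [hk]; exact contMDiffAt_extChartAt
  exact h3.comp x (contMDiff_zpow I h1 h2 k).contMDiffAt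

end CyclicQuotient

end CyclicQuotient

/-! ### Diagonal contractions and Hopf manifolds -/

/-- The coordinate space `ℂⁿ`. -/
abbrev Cn (n : ℕ) : Type := Fin n → ℂ

/-- The punctured space `W = ℂⁿ ∖ {0}`, an open submanifold of `ℂⁿ`. -/
def W (n : ℕ) : TopologicalSpace.Opens (Cn n) := ⟨{0}ᶜ, isOpen_compl_singleton⟩

/-- The data of a diagonal contraction `(z₁, …, zₙ) ↦ (μ₁ z₁, …, μₙ zₙ)` with `0 < |μᵢ| < 1`. -/
structure DiagonalContraction (n : ℕ) where
  /-- the multipliers -/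
  mu : Fin n → ℂ
  mu_ne_zero : ∀ i, mu i ≠ 0
  norm_mu_lt_one : ∀ i, ‖mu i‖ < 1

theorem continuous_scale {n : ℕ} (c : Cn n)
    (h : ∀ z : W n, (fun i => c i * z.1 i) ∈ W n) :
    Continuous fun z : W n => (⟨fun i => c i * z.1 i, h z⟩ : W n) := by
  have h0 : Continuous fun z : Cn n => fun i => c i * z i := by fun_prop
  exact Continuous.subtype_mk (h0.comp continuous_subtype_val) h

namespace DiagonalContraction

variable {n : ℕ} (D : DiagonalContraction n)

/-- The automorphism `f` of `W` given by `f(z₁, …, zₙ) = (μ₁ z₁, …, μₙ zₙ)`. -/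
def map : W n ≃ₜ W n where
  toFun z := ⟨fun i => D.mu i * z.1 i, fun h => z.2 (by
    ext i; simpa [D.mu_ne_zero i] using congrFun h i)⟩
  invFun z := ⟨fun i => (D.mu i)⁻¹ * z.1 i, fun h => z.2 (by
    ext i; simpa [D.mu_ne_zero i] using congrFun h i)⟩
  left_inv z := by ext i; simp [D.mu_ne_zero i]
  right_inv z := by ext i; simp [D.mu_ne_zero i]
  continuous_toFun := continuous_scale _ _
  continuous_invFun := continuous_scale _ _

@[simp] theorem map_apply (z : W n) (i : Fin n) : (D.map z).1 i = D.mu i * z.1 i := rfl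

theorem map_zpow_apply (k : ℤ) (z : W n) (i : Fin n) :
    ((D.map ^ k) z).1 i = D.mu i ^ k * z.1 i := by
  have hinv : ∀ (w : W n) (i : Fin n), ((D.map⁻¹ : W n ≃ₜ W n) w).1 i = (D.mu i)⁻¹ * w.1 i :=
    fun _ _ => rfl
  induction k generalizing z with
  | zero => simp
  | succ k ih =>
    rw [zpow_add_one, Homeomorph.mul_apply, ih, map_apply, zpow_add_one₀ (D.mu_ne_zero i)]
    ring
  | pred k ih =>
    rw [zpow_sub_one, Homeomorph.mul_apply, ih, hinv, zpow_sub_one₀ (D.mu_ne_zero i)]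
    ring

theorem contMDiff_map : ContMDiff 𝓘(ℂ, Cn n) 𝓘(ℂ, Cn n) ω D.map := by
  refine fun z => (ChartedSpace.liftPropWithinAt_subtypeVal_comp_iff _ _ z).1 ?_
  have h : ContDiff ℂ ω fun (z : Cn n) (i : Fin n) => D.mu i * z i :=
    contDiff_pi.2 fun i => contDiff_const.mul (contDiff_apply ℂ ℂ i)
  exact h.contMDiff.contMDiffAt.comp z contMDiff_subtype_val.contMDiffAt

theorem contMDiff_map_symm : ContMDiff 𝓘(ℂ, Cn n) 𝓘(ℂ, Cn n) ω D.map.symm := by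
  refine fun z => (ChartedSpace.liftPropWithinAt_subtypeVal_comp_iff _ _ z).1 ?_
  have h : ContDiff ℂ ω fun (z : Cn n) (i : Fin n) => (D.mu i)⁻¹ * z i :=
    contDiff_pi.2 fun i => contDiff_const.mul (contDiff_apply ℂ ℂ i)
  exact h.contMDiff.contMDiffAt.comp z contMDiff_subtype_val.contMDiffAt

theorem norm_zpow_le (z : W n) (k : ℤ) (hk : 0 < k) :
    ‖((D.map ^ k) z).1‖ ≤ ‖D.mu‖ * ‖z.1‖ := by
  refine (pi_norm_le_iff_of_nonneg (by positivity)).2 fun i => ?_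
  rw [map_zpow_apply, norm_mul, norm_zpow]
  have h1 : ‖D.mu i‖ ^ k ≤ ‖D.mu i‖ := by
    lift k to ℕ using hk.le
    rw [zpow_natCast]
    exact pow_le_of_le_one (norm_nonneg _) (D.norm_mu_lt_one i).le (by omega)
  exact mul_le_mul (h1.trans (norm_le_pi_norm D.mu i)) (norm_le_pi_norm z.1 i) (norm_nonneg _)
    (norm_nonneg _)

theorem wandering_map : CyclicQuotient.Wandering D.map := by
  intro x
  have hx : 0 < ‖x.1‖ := norm_pos_iff.2 x.2
  have hc0 : 0 < ‖D.mu‖ := by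
    refine norm_pos_iff.2 fun h => x.2 ?_
    ext i
    exact absurd (congrFun h i) (D.mu_ne_zero i)
  have hc1 : ‖D.mu‖ < 1 := (pi_norm_lt_iff one_pos).2 D.norm_mu_lt_one
  set s := √‖D.mu‖
  have hs0 : 0 < s := Real.sqrt_pos.2 hc0
  have hs1 : s < 1 := (Real.sqrt_lt' one_pos).2 (by simpa using hc1)
  have hss : s * s = ‖D.mu‖ := Real.mul_self_sqrt hc0.le
  have key : ∀ y z : W n, s * ‖y.1‖ < ‖x.1‖ → s * ‖x.1‖ < ‖z.1‖ →
      ‖z.1‖ ≤ ‖D.mu‖ * ‖y.1‖ → False := by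
    intro y z h1 h2 h3
    rw [← hss, mul_assoc] at h3
    have := mul_lt_mul_of_pos_left h1 hs0
    linarith
  refine ⟨{y | s * ‖x.1‖ < ‖y.1‖ ∧ s * ‖y.1‖ < ‖x.1‖}, IsOpen.mem_nhds ?_ ?_, ?_⟩
  · have hn : Continuous fun y : W n => ‖y.1‖ := continuous_subtype_val.norm
    exact (isOpen_lt continuous_const hn).inter
      (isOpen_lt (continuous_const.mul hn) continuous_const)
  · exact ⟨by nlinarith, by nlinarith⟩
  · intro k y hy hky
    rcases lt_trichotomy k 0 with hk | hk | hk
    · refine (key _ _ hky.2 hy.1 ?_).elim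
      have := D.norm_zpow_le ((D.map ^ k) y) (-k) (by omega)
      rwa [← Homeomorph.mul_apply, ← zpow_add, neg_add_cancel] at this
    · exact hk
    · exact (key _ _ hy.2 hky.1 (D.norm_zpow_le y k hk)).elim

/-- The Hopf manifold `X = W / ⟨f⟩`. -/
abbrev HopfManifold : Type := CyclicQuotient D.map

/-- The projection `π : W → X`. -/
def proj : W n → D.HopfManifold := CyclicQuotient.mk D.map

instance : ChartedSpace (Cn n) D.HopfManifold := CyclicQuotient.chartedSpace _ D.wandering_map

instance : IsManifold 𝓘(ℂ, Cn n) ω D.HopfManifold :=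
  CyclicQuotient.isManifold _ D.wandering_map D.contMDiff_map D.contMDiff_map_symm

theorem contMDiff_proj : ContMDiff 𝓘(ℂ, Cn n) 𝓘(ℂ, Cn n) ω D.proj :=
  CyclicQuotient.contMDiff_mk _ D.wandering_map D.contMDiff_map D.contMDiff_map_symm

/-- `X` is classical, with common multiplier `μ`: `μ = μ₁ = … = μₙ`. -/
def IsClassical (μ : ℂ) : Prop := ∀ i, D.mu i = μ

/-- There is no non-trivial relation `∏_{i ∈ A} μᵢ ^ rᵢ = ∏_{j ∈ B} μⱼ ^ rⱼ` with natural exponents,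
where `A` and `B` are disjoint with union `S`. -/
def NoRelation (S : Finset (Fin n)) : Prop :=
  ∀ (A B : Finset (Fin n)) (e : Fin n → ℕ), Disjoint A B → A ∪ B = S →
    ∏ i ∈ A, D.mu i ^ e i = ∏ j ∈ B, D.mu j ^ e j → ∀ i ∈ S, e i = 0

/-- `X` is generic: `|μ₁| ≤ … ≤ |μₙ|` and the `μᵢ` satisfy no non-trivial relation. -/
def IsGeneric : Prop := (Monotone fun i => ‖D.mu i‖) ∧ D.NoRelation Finset.univ

/-- The index set `{1, r + 1, …, n}`. As `Fin n` starts at `0`, the index `i` is represented by the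
element of `Fin n` with value `i - 1`. -/
def intermediaryIndices (n r : ℕ) : Finset (Fin n) := {i | i.val = 0 ∨ r ≤ i.val}

/-- `X` is intermediary: `μ₁ = … = μᵣ` with `2 ≤ r ≤ n - 1`, and `μ₁, μᵣ₊₁, …, μₙ` satisfy no
non-trivial relation. -/
def IsIntermediary (r : ℕ) : Prop :=
  2 ≤ r ∧ r + 1 ≤ n ∧ (∀ i j : Fin n, i.val < r → j.val < r → D.mu i = D.mu j) ∧
    D.NoRelation (intermediaryIndices n r)

/-! ### The line bundles `L_b` -/

/-- The automorphism `(z, v) ↦ (f z, b v)` of `W × ℂ`. -/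
def bundleMap (b : ℂˣ) : (W n × ℂ) ≃ₜ (W n × ℂ) :=
  D.map.prodCongr (Homeomorph.mulLeft₀ (b : ℂ) b.ne_zero)

theorem bundleMap_zpow_apply (b : ℂˣ) (k : ℤ) (p : W n × ℂ) :
    (D.bundleMap b ^ k) p = ((D.map ^ k) p.1, ((b ^ k : ℂˣ) : ℂ) * p.2) := by
  have h1 : ∀ p : W n × ℂ, D.bundleMap b p = (D.map p.1, (b : ℂ) * p.2) := fun _ => rfl
  have h2 : ∀ p : W n × ℂ, (D.bundleMap b)⁻¹ p = (D.map⁻¹ p.1, (b : ℂ)⁻¹ * p.2) := fun _ => rfl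
  induction k generalizing p with
  | zero => simp
  | succ k ih =>
    rw [zpow_add_one, Homeomorph.mul_apply, ih, h1, zpow_add_one, zpow_add_one,
      Homeomorph.mul_apply, Units.val_mul, mul_assoc]
  | pred k ih =>
    rw [zpow_sub_one, Homeomorph.mul_apply, ih, h2, zpow_sub_one, zpow_sub_one,
      Homeomorph.mul_apply, Units.val_mul, mul_assoc, Units.val_inv_eq_inv_val]

theorem wandering_bundleMap (b : ℂˣ) : CyclicQuotient.Wandering (D.bundleMap b) := by
  intro p
  obtain ⟨U, hU, h⟩ := D.wandering_map p.1
  refine ⟨Prod.fst ⁻¹' U, continuous_fst.continuousAt.preimage_mem_nhds hU, ?_⟩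
  intro k y hy hky
  rw [bundleMap_zpow_apply] at hky
  exact h k y.1 hy hky

theorem contMDiff_bundleMap (b : ℂˣ) :
    ContMDiff (𝓘(ℂ, Cn n).prod 𝓘(ℂ, ℂ)) (𝓘(ℂ, Cn n).prod 𝓘(ℂ, ℂ)) ω (D.bundleMap b) :=
  D.contMDiff_map.prodMap (contMDiff_const.mul contMDiff_id)

theorem contMDiff_bundleMap_symm (b : ℂˣ) :
    ContMDiff (𝓘(ℂ, Cn n).prod 𝓘(ℂ, ℂ)) (𝓘(ℂ, Cn n).prod 𝓘(ℂ, ℂ)) ω (D.bundleMap b).symm :=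
  D.contMDiff_map_symm.prodMap (contMDiff_const.mul contMDiff_id)

/-- The total space of the line bundle `L_b`: the quotient of `W × ℂ` by `(z, v) ↦ (f z, b v)`. -/
abbrev LineBundle (b : ℂˣ) : Type := CyclicQuotient (D.bundleMap b)

instance (b : ℂˣ) : ChartedSpace (ModelProd (Cn n) ℂ) (D.LineBundle b) :=
  CyclicQuotient.chartedSpace _ (D.wandering_bundleMap b)

instance (b : ℂˣ) : IsManifold (𝓘(ℂ, Cn n).prod 𝓘(ℂ, ℂ)) ω (D.LineBundle b) :=
  CyclicQuotient.isManifold _ (D.wandering_bundleMap b) (D.contMDiff_bundleMap b)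
    (D.contMDiff_bundleMap_symm b)

/-- The class `[z, v]` in `L_b`. -/
def lmk (b : ℂˣ) (z : W n) (v : ℂ) : D.LineBundle b := CyclicQuotient.mk _ (z, v)

/-- The bundle projection `L_b → X`, `[z, v] ↦ π z`. -/
def lproj (b : ℂˣ) : D.LineBundle b → D.HopfManifold :=
  Quotient.lift (fun p : W n × ℂ => D.proj p.1) (by
    rintro p q ⟨k, rfl⟩
    rw [bundleMap_zpow_apply]
    exact (CyclicQuotient.mk_zpow k p.1).symm)

theorem lproj_lmk (b : ℂˣ) (z : W n) (v : ℂ) : D.lproj b (D.lmk b z v) = D.proj z := rfl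

/-- The fibre of `L_b` over `x`. -/
def Fiber (b : ℂˣ) (x : D.HopfManifold) : Type := {l : D.LineBundle b // D.lproj b l = x}

/-- The element `[z, v]` of the fibre over `x = π z`. -/
def fmk (b : ℂˣ) {x : D.HopfManifold} (z : W n) (hz : D.proj z = x) (v : ℂ) : D.Fiber b x :=
  ⟨D.lmk b z v, hz⟩

theorem fmk_bijective (b : ℂˣ) {x : D.HopfManifold} (z : W n) (hz : D.proj z = x) :
    Function.Bijective (D.fmk b z hz) := by
  constructor
  · intro u v h
    obtain ⟨k, hk⟩ := CyclicQuotient.mk_eq_mk.1 (congrArg Subtype.val h)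
    rw [bundleMap_zpow_apply, Prod.mk.injEq] at hk
    obtain ⟨U, hU, hk0⟩ := D.wandering_map z
    have hz' := mem_of_mem_nhds hU
    have : k = 0 := hk0 k z hz' (by simpa only [hk.1] using hz')
    subst this
    simpa using hk.2
  · rintro ⟨l, hl⟩
    obtain ⟨⟨w, v⟩, rfl⟩ := CyclicQuotient.mk_surjective l
    obtain ⟨k, hk⟩ := CyclicQuotient.mk_eq_mk.1 (hl.trans hz.symm : D.proj w = D.proj z)
    refine ⟨((b ^ k : ℂˣ) : ℂ) * v, Subtype.ext ?_⟩
    refine (CyclicQuotient.mk_eq_mk.2 ⟨k, ?_⟩).symm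
    rw [bundleMap_zpow_apply]
    exact congrArg (·, ((b ^ k : ℂˣ) : ℂ) * v) hk

/-- The identification of the fibre over `π z` with `ℂ`, `v ↦ [z, v]`. -/
def fiberEquiv (b : ℂˣ) {x : D.HopfManifold} (z : W n) (hz : D.proj z = x) : ℂ ≃ D.Fiber b x :=
  Equiv.ofBijective _ (D.fmk_bijective b z hz)

/-- A chosen point of `W` over `x`. -/
def lift (x : D.HopfManifold) : W n := (CyclicQuotient.mk_surjective x).choose

theorem proj_lift (x : D.HopfManifold) : D.proj (D.lift x) = x :=
  (CyclicQuotient.mk_surjective x).choose_spec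

/- The vector space structure of the fibres is the one for which all the identifications
`v ↦ [z, v]` are linear, see `fmk_add` and `fmk_smul`; it does not depend on the chosen lift. -/

instance (b : ℂˣ) (x : D.HopfManifold) : AddCommGroup (D.Fiber b x) :=
  (D.fiberEquiv b (D.lift x) (D.proj_lift x)).symm.addCommGroup

instance (b : ℂˣ) (x : D.HopfManifold) : Module ℂ (D.Fiber b x) :=
  (D.fiberEquiv b (D.lift x) (D.proj_lift x)).symm.module ℂ

theorem exists_fmk_eq (b : ℂˣ) {x : D.HopfManifold} (z : W n) (hz : D.proj z = x) :
    ∃ c : ℂ, ∀ v, D.fmk b z hz v =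
      D.fiberEquiv b (D.lift x) (D.proj_lift x) (c * v) := by
  obtain ⟨k, hk⟩ := CyclicQuotient.mk_eq_mk.1 (hz.trans (D.proj_lift x).symm)
  refine ⟨((b ^ k : ℂˣ) : ℂ), fun v => Subtype.ext ?_⟩
  refine CyclicQuotient.mk_eq_mk.2 ⟨k, ?_⟩
  rw [bundleMap_zpow_apply]
  exact congrArg (·, ((b ^ k : ℂˣ) : ℂ) * v) hk

theorem fmk_add (b : ℂˣ) {x : D.HopfManifold} (z : W n) (hz : D.proj z = x) (u v : ℂ) :
    D.fmk b z hz (u + v) = D.fmk b z hz u + D.fmk b z hz v := by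
  obtain ⟨c, hc⟩ := D.exists_fmk_eq b z hz
  rw [Equiv.add_def, hc, hc, hc]
  simp [mul_add]

theorem fmk_smul (b : ℂˣ) {x : D.HopfManifold} (z : W n) (hz : D.proj z = x) (a v : ℂ) :
    D.fmk b z hz (a * v) = a • D.fmk b z hz v := by
  obtain ⟨c, hc⟩ := D.exists_fmk_eq b z hz
  rw [Equiv.smul_def, hc, hc]
  simp [mul_left_comm]

/-! ### Nonsingular codimension-one distributions with conormal bundle `L_b` -/

/-- The cotangent space of `X` at `x`, the fibre of the bundle `Ω¹_X`. -/
abbrev Cotangent (x : D.HopfManifold) : Type :=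
  TangentSpace 𝓘(ℂ, Cn n) x →L[ℂ] Bundle.Trivial D.HopfManifold ℂ x

/-- A nonsingular codimension-one holomorphic distribution on `X` given by a morphism
`L_b → Ω¹_X`: a holomorphic map from the total space of `L_b` to that of the cotangent bundle which
is linear and injective on each fibre. -/
structure Distribution (b : ℂˣ) where
  /-- the morphism `L_b → Ω¹_X` on fibres -/
  toFun : ∀ x : D.HopfManifold, D.Fiber b x →ₗ[ℂ] D.Cotangent x
  holomorphic : MDifferentiable (𝓘(ℂ, Cn n).prod 𝓘(ℂ, ℂ)) (𝓘(ℂ, Cn n).prod 𝓘(ℂ, Cn n →L[ℂ] ℂ))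
    (fun l : D.LineBundle b =>
      (⟨D.lproj b l, toFun (D.lproj b l) ⟨l, rfl⟩⟩ :
        Bundle.TotalSpace (Cn n →L[ℂ] ℂ) D.Cotangent))
  injective : ∀ x, Function.Injective (toFun x)

variable {D} {b : ℂˣ}

/-- The hyperplane `F_x ⊆ T_x X`: the common kernel of the covectors in the image of `L_b`. -/
def Distribution.hyperplane (F : D.Distribution b) (x : D.HopfManifold) :
    Submodule ℂ (TangentSpace 𝓘(ℂ, Cn n) x) :=
  ⨅ l : D.Fiber b x, LinearMap.ker (F.toFun x l).toLinearMap

/-- `F` is induced by the holomorphic `1`-form `η` on `W`: at every point `z` of `W`, the pull-back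
of `F` to `W` is the kernel of `η z`. -/
def Distribution.IsInducedBy (F : D.Distribution b) (η : Cn n → (Cn n →L[ℂ] ℂ)) : Prop :=
  ∀ z : W n, (F.hyperplane (D.proj z)).comap
    (mfderiv 𝓘(ℂ, Cn n) 𝓘(ℂ, Cn n) D.proj z).toLinearMap = LinearMap.ker (η z.1).toLinearMap

end DiagonalContraction

/-- The coordinate form `dzⱼ` on `ℂⁿ`. -/
def dz {n : ℕ} (j : Fin n) : Cn n →L[ℂ] ℂ := ContinuousLinearMap.proj j

end Hopf

end

/-! ### Eigenfunctions of a diagonal contraction are polynomials. -/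

noncomputable section

namespace Hopf

/-! Evaluating the morphism on `[z, 1]` and pulling back by π gives a nowhere zero holomorphic form
ω = ∑ gᵢ dzᵢ on W whose kernel is the lifted distribution (`isInducedBy_iff`). In `L_b` one has `[f
z, 1] = b⁻¹ [z, 1]`, so f*ω = b⁻¹ω, that is, gᵢ ∘ f = μᵢ⁻¹ b⁻¹ gᵢ.

Such eigenfunctions are polynomials (`exists_mvPolynomial_of_eigenfunction`): the scaling relation
forces polynomial growth, and interpolation in one variable at a time turns growth into
polynomiality. Comparing coefficients, every term z^d dzᵢ of ω satisfies μ^(d + eᵢ) = b⁻¹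
(`exists_polynomial_form`).

In the classical case this equation fixes the degree of d, because powers of μ are distinct. In the
other two cases, a map β sends each index to a representative with the same multiplier, and the
absence of relations makes the weight β(d + eᵢ) one and the same l for all terms. Since ω has no
zero on the coordinate axes, l is supported on very few indices. Having at least three axes (generic
case), or the fact that a homogeneous polynomial of positive degree has a nontrivial zero on a plane
(intermediary case), forces l to have degree one. All coefficients are then constant. -/

/-- An entire function of polynomial growth is a polynomial. -/
theorem exists_polynomial_of_growth {h : ℂ → ℂ} (hh : Differentiable ℂ h) {C : ℝ} {N : ℕ}
    (hC : ∀ z : ℂ, 1 ≤ ‖z‖ → ‖h z‖ ≤ C * ‖z‖ ^ N) :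
    ∃ p : Polynomial ℂ, p.degree < (N + 1 : ℕ) ∧ ∀ z, p.eval z = h z := by
  have hz : ∀ k, N < k → iteratedDeriv k h 0 = 0 := by
    intro k hk
    -- Cauchy's estimate on the circle of radius `R` gives k! C R^N / R^k, and `N < k` leaves at
    -- least one factor R⁻¹; then R → ∞.
    have hb : ∀ R : ℝ, 1 ≤ R → ‖iteratedDeriv k h 0‖ ≤ k.factorial * C * R⁻¹ := by
      intro R hR
      have hR0 : 0 < R := one_pos.trans_le hR
      have hC0 : 0 ≤ C := by
        have := (norm_nonneg _).trans (hC 1 (by simp))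
        simpa using this
      have h1 := Complex.norm_iteratedDeriv_le_of_forall_mem_sphere_norm_le (c := 0)
        (C := C * R ^ N) k hR0 hh.diffContOnCl (fun z hz => by
          have hz' : ‖z‖ = R := by simpa using hz
          simpa [hz'] using hC z (by rw [hz']; exact hR))
      refine h1.trans ?_
      rw [div_le_iff₀ (by positivity)]
      have h2 : R ^ (N + 1) ≤ R ^ k := pow_le_pow_right₀ hR hk
      calc (k.factorial : ℝ) * (C * R ^ N) = k.factorial * C * R⁻¹ * R ^ (N + 1) := by
            rw [pow_succ]; field_simp
        _ ≤ _ := by gcongr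
    have ht : Filter.Tendsto (fun R : ℝ => k.factorial * C * R⁻¹) Filter.atTop (𝓝 0) := by
      simpa using tendsto_inv_atTop_zero.const_mul ((k.factorial : ℝ) * C)
    have := ge_of_tendsto ht (Filter.eventually_atTop.2 ⟨1, hb⟩)
    exact norm_le_zero_iff.1 this
  refine ⟨∑ k ∈ Finset.range (N + 1),
    Polynomial.C ((k.factorial : ℂ)⁻¹ * iteratedDeriv k h 0) * Polynomial.X ^ k, ?_, fun z => ?_⟩
  · refine (Polynomial.degree_sum_le _ _).trans_lt ((Finset.sup_lt_iff (WithBot.bot_lt_coe _)).2 ?_)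
    intro k hk
    exact (Polynomial.degree_C_mul_X_pow_le _ _).trans_lt
      (by exact_mod_cast Finset.mem_range.1 hk)
  · rw [← Complex.taylorSeries_eq_of_entire' 0 z hh, tsum_eq_sum (s := Finset.range (N + 1))]
    · simp [Polynomial.eval_finsetSum]
    · intro k hk
      rw [hz k (by simpa using hk)]
      simp

section Eigenfunction

variable {n : ℕ}

/-- A function on the punctured space which is multiplied by a constant under a diagonal
contraction has polynomial growth at infinity. -/
theorem exists_growth {mu : Cn n} (h0 : ∀ i, mu i ≠ 0) (h1 : ∀ i, ‖mu i‖ < 1) {g : Cn n → ℂ}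
    (hg : ContinuousOn g {0}ᶜ) {c : ℂ} (hc : c ≠ 0) (hgc : ∀ z ≠ 0, g (mu * z) = c * g z) :
    ∃ (C : ℝ) (N : ℕ), 0 ≤ C ∧ ∀ z, 1 ≤ ‖z‖ → ‖g z‖ ≤ C * ‖z‖ ^ N := by
  have hρ1 : ‖mu‖ < 1 := (pi_norm_lt_iff one_pos).2 h1
  -- With ‖μ‖^N < ‖c‖, the bound at μz implies the same bound at z, since g(z) = c⁻¹ g(μz). The
  -- constant does not deteriorate as the bound moves outwards.
  obtain ⟨N, hN⟩ := exists_pow_lt_of_lt_one (norm_pos_iff.2 hc) hρ1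
  have hν : ∀ z : Cn n, z = mu⁻¹ * (mu * z) := fun z => by
    ext i; simp [h0 i]
  -- The shell 1 ≤ ‖z‖ ≤ B is thick enough that multiplication by μ cannot carry a point from beyond
  -- it into the open unit ball.
  set B := max 1 ‖mu⁻¹‖
  have hB : 1 ≤ B := le_max_left _ _
  have hK : IsCompact (Metric.closedBall (0 : Cn n) B \ Metric.ball 0 1) :=
    (isCompact_closedBall _ _).diff Metric.isOpen_ball
  obtain ⟨C, hC⟩ := hK.exists_bound_of_continuousOn (hg.mono (fun z hz => by
    rintro rfl
    simp at hz))
  have hmul : ∀ z : Cn n, ‖mu * z‖ ≤ ‖mu‖ * ‖z‖ := fun z => norm_mul_le _ _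
  refine ⟨max C 0, N, le_max_right _ _, ?_⟩
  have key : ∀ k : ℕ, ∀ z : Cn n, 1 ≤ ‖z‖ → ‖mu‖ ^ k * ‖z‖ ≤ B →
      ‖g z‖ ≤ max C 0 * ‖z‖ ^ N := by
    have hbase : ∀ z : Cn n, 1 ≤ ‖z‖ → ‖z‖ ≤ B → ‖g z‖ ≤ max C 0 * ‖z‖ ^ N := by
      intro z hz hzB
      refine (hC z ⟨by simpa using hzB, by simpa using hz⟩).trans ((le_max_left C 0).trans ?_)
      exact le_mul_of_one_le_right (le_max_right _ _) (one_le_pow₀ hz)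
    intro k
    induction k with
    | zero => intro z hz hzB; exact hbase z hz (by simpa using hzB)
    | succ k ih =>
      intro z hz hzB
      rcases le_or_gt ‖z‖ B with hzB' | hzB'
      · exact hbase z hz hzB'
      · have hmz : 1 ≤ ‖mu * z‖ := by
          by_contra! hlt
          have h2 : ‖z‖ ≤ ‖mu⁻¹‖ * ‖mu * z‖ := by
            conv_lhs => rw [hν z]
            exact norm_mul_le _ _
          have h3 : ‖mu⁻¹‖ * ‖mu * z‖ ≤ B * 1 :=
            mul_le_mul (le_max_right _ _) hlt.le (norm_nonneg _) (by linarith)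
          linarith
        have h4 := ih (mu * z) hmz (by
          refine le_trans ?_ hzB
          rw [pow_succ, mul_assoc]
          gcongr
          exact hmul z)
        rw [hgc z (by rintro rfl; simp at hz; linarith), norm_mul] at h4
        have h5 : max C 0 * ‖mu * z‖ ^ N ≤ ‖c‖ * (max C 0 * ‖z‖ ^ N) := by
          calc max C 0 * ‖mu * z‖ ^ N ≤ max C 0 * (‖mu‖ * ‖z‖) ^ N := by
                gcongr; exact hmul z
            _ = ‖mu‖ ^ N * (max C 0 * ‖z‖ ^ N) := by rw [mul_pow]; ring
            _ ≤ _ := by gcongr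
        exact le_of_mul_le_mul_left (h4.trans h5) (norm_pos_iff.2 hc)
  intro z hz
  have ht : Filter.Tendsto (fun k : ℕ => ‖mu‖ ^ k * ‖z‖) Filter.atTop (𝓝 0) := by
    simpa using (tendsto_pow_atTop_nhds_zero_of_lt_one (norm_nonneg _) hρ1).mul_const ‖z‖
  obtain ⟨k, hk⟩ := (ht.eventually (ge_mem_nhds (one_pos.trans_le hB))).exists
  exact key k z hz hk

/-- Takes the place of Hartogs' theorem: a line parallel to an axis through a point off the
coordinate hyperplanes avoids the origin, so a function holomorphic on W restricts to an entire
function on it. -/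
theorem update_ne_zero_of_forall_ne_zero (hn : 2 ≤ n) {z : Cn n} (hz : ∀ i, z i ≠ 0) (i : Fin n)
    (x : ℂ) : Function.update z i x ≠ 0 := by
  intro h
  have : Nontrivial (Fin n) := Fin.nontrivial_iff_two_le.2 hn
  obtain ⟨j, hj⟩ := exists_ne i
  have := congrFun h j
  rw [Function.update_of_ne hj] at this
  exact hz j this

/-- The nonzero interpolation nodes `1, 2, …, N + 1`. -/
def node (j : ℕ) : ℂ := (j : ℂ) + 1

theorem node_injective : Function.Injective node := fun a b h => by
  simpa [node] using h

theorem node_ne_zero (j : ℕ) : node j ≠ 0 := Nat.cast_add_one_ne_zero j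

/-- Interpolation of a holomorphic function of polynomial growth in one of its variables. -/
theorem eq_sum_update (hn : 2 ≤ n) {g : Cn n → ℂ} (hg : DifferentiableOn ℂ g {0}ᶜ) {C : ℝ} {N : ℕ}
    (hC0 : 0 ≤ C) (hC : ∀ z, 1 ≤ ‖z‖ → ‖g z‖ ≤ C * ‖z‖ ^ N) {z : Cn n} (hz : ∀ i, z i ≠ 0)
    (i : Fin n) :
    g z = ∑ j ∈ Finset.range (N + 1), g (Function.update z i (node j)) *
      (Lagrange.basis (Finset.range (N + 1)) node j).eval (z i) := by
  set h : ℂ → ℂ := fun x => g (Function.update z i x)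
  have hu : ∀ x, HasFDerivAt (Function.update z i) _ x := fun x => hasFDerivAt_update (𝕜 := ℂ) z x
  have hh : Differentiable ℂ h := fun x =>
    (hg.differentiableAt (isOpen_compl_singleton.mem_nhds
      (update_ne_zero_of_forall_ne_zero hn hz i x))).comp x (hu x).differentiableAt
  obtain ⟨p, hp, hpe⟩ := exists_polynomial_of_growth hh (C := C * (1 + ‖z‖) ^ N) (N := N) (by
    intro x hx
    have h1 : ‖x‖ ≤ ‖Function.update z i x‖ := by
      simpa using norm_le_pi_norm (Function.update z i x) i
    have h2 : ‖Function.update z i x‖ ≤ (1 + ‖z‖) * ‖x‖ := by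
      refine (pi_norm_le_iff_of_nonneg (by positivity)).2 fun j => ?_
      rcases eq_or_ne j i with rfl | hj
      · rw [Function.update_self]; nlinarith [norm_nonneg z, norm_nonneg x]
      · rw [Function.update_of_ne hj]
        have := norm_le_pi_norm z j
        nlinarith [norm_nonneg z, norm_nonneg x]
    refine (hC _ (hx.trans h1)).trans ?_
    rw [mul_assoc, ← mul_pow]
    gcongr)
  have h1 := Lagrange.eq_interpolate (s := Finset.range (N + 1)) (v := node)
    node_injective.injOn (by simpa using hp)
  have h2 : g z = p.eval (z i) := by rw [hpe]; simp [h]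
  conv_lhs => rw [h2, h1]
  rw [Lagrange.interpolate_apply, Polynomial.eval_finsetSum]
  refine Finset.sum_congr rfl fun j _ => ?_
  rw [Polynomial.eval_mul, Polynomial.eval_C, hpe]

-- Induction on the set `s` of free coordinates. Interpolation in coordinate `i` expresses g through
-- its slices zᵢ = `node j`, on which one coordinate fewer is free. The nodes are nonzero so that
-- the slices stay off the coordinate hyperplanes.
open MvPolynomial in
theorem exists_mvPolynomial_of_growth (hn : 2 ≤ n) {g : Cn n → ℂ}
    (hg : DifferentiableOn ℂ g {0}ᶜ) {C : ℝ} {N : ℕ}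
    (hC0 : 0 ≤ C) (hC : ∀ z, 1 ≤ ‖z‖ → ‖g z‖ ≤ C * ‖z‖ ^ N) (s : Finset (Fin n)) :
    ∀ w : Cn n, (∀ i, w i ≠ 0) → ∃ P : MvPolynomial (Fin n) ℂ,
      ∀ z : Cn n, (∀ i, z i ≠ 0) → (∀ i ∉ s, z i = w i) → eval z P = g z := by
  induction s using Finset.induction_on with
  | empty =>
    intro w _
    refine ⟨MvPolynomial.C (g w), fun z _ hz => ?_⟩
    rw [eval_C, funext fun i => hz i (Finset.notMem_empty i)]
  | insert i s _ ih =>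
    intro w hw
    have hw' : ∀ j k, Function.update w i (node j) k ≠ 0 := by
      intro j k
      rcases eq_or_ne k i with rfl | hk
      · simpa using node_ne_zero j
      · simpa [hk] using hw k
    choose P hP using fun j => ih (Function.update w i (node j)) (hw' j)
    refine ⟨∑ j ∈ Finset.range (N + 1),
      -- `P j` agrees with g only where the i-th coordinate is `node j`, so that value is
      -- substituted for `X i`.
      bind₁ (Function.update X i (MvPolynomial.C (node j))) (P j) *
      Polynomial.aeval (X i) (Lagrange.basis (Finset.range (N + 1)) node j), ?_⟩
    intro z hz hzw
    rw [eq_sum_update hn hg hC0 hC hz i, map_sum]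
    refine Finset.sum_congr rfl fun j _ => ?_
    have h1 : eval z (bind₁ (Function.update X i (MvPolynomial.C (node j))) (P j))
        = g (Function.update z i (node j)) := by
      rw [← hP j (Function.update z i (node j))]
      · rw [← coe_aeval_eq_eval, RingHom.coe_coe, aeval_bind₁, ← coe_aeval_eq_eval,
          RingHom.coe_coe]
        congr 2
        ext k
        rcases eq_or_ne k i with rfl | hk
        · simp
        · simp [hk]
      · intro k
        rcases eq_or_ne k i with rfl | hk
        · simpa using node_ne_zero j
        · simpa [hk] using hz k
      · intro k hk
        rcases eq_or_ne k i with rfl | hki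
        · simp
        · simpa [hki] using hzw k (by simp [hk, hki])
    have h2 : eval z (Polynomial.aeval (X i : MvPolynomial (Fin n) ℂ)
        (Lagrange.basis (Finset.range (N + 1)) node j))
        = (Lagrange.basis (Finset.range (N + 1)) node j).eval (z i) := by
      rw [← coe_aeval_eq_eval, RingHom.coe_coe, ← Polynomial.aeval_algHom_apply, aeval_X,
        Polynomial.coe_aeval_eq_eval]
    rw [map_mul, h1, h2]

theorem dense_forall_ne_zero : Dense {z : Cn n | ∀ i, z i ≠ 0} := by
  have : {z : Cn n | ∀ i, z i ≠ 0} = Set.univ.pi fun _ => ({0}ᶜ : Set ℂ) := by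
    ext z; simp [Set.mem_pi]
  rw [this]
  exact dense_pi _ fun i _ => dense_compl_singleton 0

/-- Monomials are eigenvectors of z ↦ μz, so the eigenvalue of a polynomial can be read off from any
term in its support. -/
theorem coeff_bind₁_C_mul_X (mu : Cn n) (P : MvPolynomial (Fin n) ℂ) (d : Fin n →₀ ℕ) :
    MvPolynomial.coeff d (MvPolynomial.bind₁ (fun i => MvPolynomial.C (mu i) * MvPolynomial.X i) P)
      = (d.prod fun i k => mu i ^ k) * MvPolynomial.coeff d P := by
  induction P using MvPolynomial.induction_on' with
  | monomial e a =>
    have h : MvPolynomial.bind₁ (fun i => MvPolynomial.C (mu i) * MvPolynomial.X i)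
        (MvPolynomial.monomial e a)
        = MvPolynomial.C (e.prod fun i k => mu i ^ k) * MvPolynomial.monomial e a := by
      rw [MvPolynomial.bind₁_monomial, MvPolynomial.monomial_eq, Finsupp.prod, Finsupp.prod]
      simp only [mul_pow, Finset.prod_mul_distrib, map_prod, map_pow]
      ring
    rw [h, MvPolynomial.coeff_C_mul, MvPolynomial.coeff_monomial]
    split_ifs with hed
    · rw [hed]
    · simp
  | add p q hp hq => rw [map_add, MvPolynomial.coeff_add, hp, hq, MvPolynomial.coeff_add, mul_add]

/-- An eigenfunction of a diagonal contraction on `ℂⁿ ∖ {0}`, `n ≥ 2`, is a linear combination of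
the monomials with the same eigenvalue. -/
theorem exists_mvPolynomial_of_eigenfunction (hn : 2 ≤ n) {mu : Cn n} (h0 : ∀ i, mu i ≠ 0)
    (h1 : ∀ i, ‖mu i‖ < 1) {g : Cn n → ℂ} (hg : DifferentiableOn ℂ g {0}ᶜ) {c : ℂ} (hc : c ≠ 0)
    (hgc : ∀ z ≠ 0, g (mu * z) = c * g z) :
    ∃ P : MvPolynomial (Fin n) ℂ, (∀ z ≠ 0, MvPolynomial.eval z P = g z) ∧
      ∀ d ∈ P.support, (d.prod fun i k => mu i ^ k) = c := by
  obtain ⟨C, N, hC0, hC⟩ := exists_growth h0 h1 hg.continuousOn hc hgc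
  obtain ⟨P, hP⟩ := exists_mvPolynomial_of_growth hn hg hC0 hC Finset.univ 1 (by simp)
  -- Equality is known off the coordinate hyperplanes, a dense set; continuity of both sides extends
  -- it to W.
  have hP' : ∀ z ≠ 0, MvPolynomial.eval z P = g z := by
    intro z hz
    have hcl : z ∈ closure {z : Cn n | ∀ i, z i ≠ 0} := dense_forall_ne_zero z
    have hne : (𝓝[{z : Cn n | ∀ i, z i ≠ 0}] z).NeBot := mem_closure_iff_nhdsWithin_neBot.1 hcl
    have t1 : Filter.Tendsto (fun z => MvPolynomial.eval z P)
        (𝓝[{z : Cn n | ∀ i, z i ≠ 0}] z) (𝓝 (MvPolynomial.eval z P)) :=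
      (MvPolynomial.continuous_eval P).continuousAt.tendsto.mono_left nhdsWithin_le_nhds
    have t2 : Filter.Tendsto g (𝓝[{z : Cn n | ∀ i, z i ≠ 0}] z) (𝓝 (g z)) :=
      (hg.continuousOn.continuousAt (isOpen_compl_singleton.mem_nhds hz)).tendsto.mono_left
        nhdsWithin_le_nhds
    refine tendsto_nhds_unique (t1.congr' ?_) t2
    filter_upwards [self_mem_nhdsWithin] with w hw
    exact hP w hw (by simp)
  refine ⟨P, hP', fun d hd => ?_⟩
  set Q := MvPolynomial.bind₁ (fun i => MvPolynomial.C (mu i) * MvPolynomial.X i) P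
  have hQe : ∀ z, MvPolynomial.eval z Q = MvPolynomial.eval (mu * z) P := by
    intro z
    rw [← MvPolynomial.coe_aeval_eq_eval, RingHom.coe_coe, MvPolynomial.aeval_bind₁,
      ← MvPolynomial.coe_aeval_eq_eval, RingHom.coe_coe]
    congr 2
    ext k
    simp
  have hQ : Q = MvPolynomial.C c * P := by
    refine MvPolynomial.funext_set (fun _ => ({0}ᶜ : Set ℂ)) (fun _ => ?_) fun z hz => ?_
    · exact (Set.finite_singleton (0 : ℂ)).infinite_compl
    · have hi : ∀ i, z i ≠ 0 := fun i => hz i (Set.mem_univ i)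
      have hz0 : z ≠ 0 := fun h => hi ⟨0, by omega⟩ (congrFun h _)
      have hmz : mu * z ≠ 0 := fun h => mul_ne_zero (h0 ⟨0, by omega⟩) (hi ⟨0, by omega⟩)
        (congrFun h _)
      rw [hQe, map_mul, MvPolynomial.eval_C, hP' _ hmz, hP' _ hz0, hgc z hz0]
  have hQc : MvPolynomial.coeff d Q = (d.prod fun i k => mu i ^ k) * MvPolynomial.coeff d P :=
    coeff_bind₁_C_mul_X mu P d
  rw [hQ, MvPolynomial.coeff_C_mul] at hQc
  exact (mul_right_cancel₀ (MvPolynomial.mem_support_iff.1 hd) hQc).symm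

end Eigenfunction
end Hopf

end

/-! ### The lifted form on W: equivariance, holomorphy, absence of zeros. -/

noncomputable section

namespace Hopf

open Bundle

variable {n : ℕ}

theorem extChartAt_punctured (z w : W n) : extChartAt 𝓘(ℂ, Cn n) z w = w.1 := by
  simp [extChartAt, TopologicalSpace.Opens.chartAt_eq, chartAt_self_eq]

theorem coe_extChartAt_symm_punctured (z : W n) {y : Cn n}
    (hy : y ∈ (extChartAt 𝓘(ℂ, Cn n) z).target) :
    ((extChartAt 𝓘(ℂ, Cn n) z).symm y).1 = y := by
  rw [← extChartAt_punctured z, PartialEquiv.right_inv _ hy]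

theorem mfderiv_punctured_coe (z : W n) :
    mfderiv 𝓘(ℂ, Cn n) 𝓘(ℂ, Cn n) (Subtype.val : W n → Cn n) z
      = ContinuousLinearMap.id ℂ (Cn n) := by
  have h : (Subtype.val : W n → Cn n) = extChartAt 𝓘(ℂ, Cn n) z :=
    funext fun w => (extChartAt_punctured z w).symm
  rw [h]
  exact mfderiv_extChartAt_self

theorem mdifferentiable_punctured_coe :
    MDifferentiable 𝓘(ℂ, Cn n) 𝓘(ℂ, Cn n) (Subtype.val : W n → Cn n) :=
  (contMDiff_subtype_val (n := 1)).mdifferentiable one_ne_zero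

/-- The preferred local inverse of the inclusion `W → ℂⁿ` has the identity as its derivative. -/
theorem mfderiv_extChartAt_symm_punctured (z : W n) {y : Cn n}
    (hy : y ∈ (extChartAt 𝓘(ℂ, Cn n) z).target) :
    mfderiv 𝓘(ℂ, Cn n) 𝓘(ℂ, Cn n) (extChartAt 𝓘(ℂ, Cn n) z).symm y
      = ContinuousLinearMap.id ℂ (Cn n) := by
  have ho : IsOpen (extChartAt 𝓘(ℂ, Cn n) z).target := isOpen_extChartAt_target z
  have hs : MDifferentiableAt 𝓘(ℂ, Cn n) 𝓘(ℂ, Cn n) (extChartAt 𝓘(ℂ, Cn n) z).symm y :=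
    ((contMDiffOn_extChartAt_symm (n := 1) z).contMDiffAt (ho.mem_nhds hy)).mdifferentiableAt
      one_ne_zero
  have h1 := mfderiv_comp y (mdifferentiable_punctured_coe _) hs
  have h2 : (Subtype.val ∘ (extChartAt 𝓘(ℂ, Cn n) z).symm : Cn n → Cn n) =ᶠ[𝓝 y] id := by
    filter_upwards [ho.mem_nhds hy] with w hw
    exact coe_extChartAt_symm_punctured z hw
  rw [h2.mfderiv_eq, mfderiv_id, mfderiv_punctured_coe] at h1
  exact h1.symm

namespace DiagonalContraction

variable (D : DiagonalContraction n)

/-- The diagonal linear map which `f` extends to. -/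
def diag : Cn n →L[ℂ] Cn n := ContinuousLinearMap.pi fun i => D.mu i • dz i

theorem diag_apply (v : Cn n) (i : Fin n) : D.diag v i = D.mu i * v i := rfl

theorem mfderiv_map (z : W n) :
    mfderiv 𝓘(ℂ, Cn n) 𝓘(ℂ, Cn n) D.map z = D.diag := by
  have h1 := mfderiv_comp z (mdifferentiable_punctured_coe (D.map z))
    (D.contMDiff_map.mdifferentiable (by simp) z)
  have h2 : (Subtype.val ∘ D.map : W n → Cn n) = D.diag ∘ Subtype.val := rfl
  rw [h2, mfderiv_comp z (D.diag.differentiableAt.mdifferentiableAt)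
    (mdifferentiable_punctured_coe z), mfderiv_punctured_coe, mfderiv_punctured_coe,
    mfderiv_eq_fderiv, ContinuousLinearMap.fderiv] at h1
  exact h1.symm

theorem mdifferentiable_proj : MDifferentiable 𝓘(ℂ, Cn n) 𝓘(ℂ, Cn n) D.proj :=
  D.contMDiff_proj.mdifferentiable (by simp)

theorem proj_map (z : W n) : D.proj (D.map z) = D.proj z := by
  have h := CyclicQuotient.mk_zpow (f := D.map) 1 z
  rwa [zpow_one] at h

/-- The preferred chart at x is a local inverse of π around a chosen preimage `a`, followed by the
inclusion into ℂⁿ. Read in that chart, π is the inclusion near `a`. -/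
theorem exists_mfderiv_proj_eq_id (x : D.HopfManifold) :
    ∃ a : W n, D.proj a = x ∧
      mfderiv 𝓘(ℂ, Cn n) 𝓘(ℂ, Cn n) D.proj a = ContinuousLinearMap.id ℂ (Cn n) := by
  set hL := CyclicQuotient.isLocalHomeomorph_mk D.wandering_map
  set a := CyclicQuotient.mk_surjective.hasRightInverse.choose x with ha
  have hax : D.proj a = x := CyclicQuotient.mk_surjective.hasRightInverse.choose_spec x
  refine ⟨a, hax, ?_⟩
  have hch : chartAt (Cn n) x = (hL.localInverseAt a).trans (chartAt (Cn n) a) := rfl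
  have h1 := mfderiv_comp a
    (mdifferentiableAt_extChartAt (I := 𝓘(ℂ, Cn n)) (x := x) (y := D.proj a)
      (by rw [hax]; exact mem_chart_source _ x)) (D.mdifferentiable_proj a)
  have h2 : (extChartAt 𝓘(ℂ, Cn n) x ∘ D.proj) =ᶠ[𝓝 a] (Subtype.val : W n → Cn n) := by
    have m1 : ∀ᶠ z in 𝓝 a, D.proj z ∈ (hL.localInverseAt a).source :=
      CyclicQuotient.continuous_mk.continuousAt.preimage_mem_nhds
        ((hL.localInverseAt a).open_source.mem_nhds hL.apply_self_mem_localInverseAt_source)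
    have m2 : ∀ᶠ z in 𝓝 a, z ∈ (hL.localInverseAt a).target :=
      (hL.localInverseAt a).open_target.mem_nhds hL.self_mem_localInverseAt_target
    filter_upwards [m1, m2] with z hz1 hz2
    have hz : hL.localInverseAt a (D.proj z) = z :=
      hL.injOn_localInverseAt_target ((hL.localInverseAt a).map_source hz1) hz2
        (hL.apply_localInverseAt_of_mem hz1)
    rw [← extChartAt_punctured a z]
    simp only [Function.comp_apply, extChartAt, OpenPartialHomeomorph.extend, hch]
    simp [hz]
  rw [h2.mfderiv_eq, mfderiv_punctured_coe] at h1
  have h3 : mfderiv 𝓘(ℂ, Cn n) 𝓘(ℂ, Cn n) (extChartAt 𝓘(ℂ, Cn n) x) (D.proj a)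
      = ContinuousLinearMap.id ℂ (Cn n) := by
    rw [hax]; exact mfderiv_extChartAt_self
  rw [h3] at h1
  exact h1.symm

namespace Distribution

variable {D} {b : ℂˣ} (F : D.Distribution b)

/-- The pull-back to `W` of the distribution, as a form on `W`: the pull-back of the covector
associated with `[z, 1]`. -/
def coverForm (z : W n) : Cn n →L[ℂ] ℂ :=
  ContinuousLinearMap.comp (F.toFun (D.proj z) (D.fmk b z rfl 1))
    (mfderiv 𝓘(ℂ, Cn n) 𝓘(ℂ, Cn n) D.proj z)

/-- Combines π ∘ f = π, differentiated, with `[f z, b] = [z, 1]`, which gives `[f z, 1] = b⁻¹ [z,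
1]`. -/
theorem coverForm_map (z : W n) (v : Cn n) :
    F.coverForm (D.map z) (D.diag v) = (b : ℂ)⁻¹ * F.coverForm z v := by
  -- The base points π(f z) and π z are equal but not definitionally so; vectors here, and covectors
  -- in `hF`, are therefore compared through the model space.
  have hd : (mfderiv 𝓘(ℂ, Cn n) 𝓘(ℂ, Cn n) D.proj (D.map z) (D.diag v) : Cn n)
      = mfderiv 𝓘(ℂ, Cn n) 𝓘(ℂ, Cn n) D.proj z v := by
    have h1 := mfderiv_comp z (D.mdifferentiable_proj (D.map z))
      (D.contMDiff_map.mdifferentiable (by simp) z)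
    have h2 : ∀ g : W n → D.HopfManifold, g = D.proj →
        (mfderiv 𝓘(ℂ, Cn n) 𝓘(ℂ, Cn n) g z v : Cn n)
          = mfderiv 𝓘(ℂ, Cn n) 𝓘(ℂ, Cn n) D.proj z v := by
      rintro _ rfl; rfl
    rw [← h2 _ (funext D.proj_map), ← D.mfderiv_map z]
    exact (DFunLike.congr_fun h1 v).symm
  have hF : ∀ (w : W n) (x : D.HopfManifold) (hx : D.proj w = x) (t : Cn n),
      (F.toFun (D.proj w) (D.fmk b w rfl 1) : Cn n →L[ℂ] ℂ) t
        = (F.toFun x (D.fmk b w hx 1) : Cn n →L[ℂ] ℂ) t := by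
    rintro w _ rfl t; rfl
  have hb : D.fmk b (D.map z) (D.proj_map z) 1 = (b : ℂ)⁻¹ • D.fmk b z rfl 1 := by
    have h1 : D.fmk b (D.map z) (D.proj_map z) (b : ℂ) = D.fmk b z rfl 1 := by
      refine Subtype.ext (CyclicQuotient.mk_eq_mk.2 ⟨1, ?_⟩).symm
      rw [bundleMap_zpow_apply]
      simp
    rw [← h1, ← fmk_smul, inv_mul_cancel₀ b.ne_zero]
  change (F.toFun (D.proj (D.map z)) (D.fmk b (D.map z) rfl 1) : Cn n →L[ℂ] ℂ)
    (mfderiv 𝓘(ℂ, Cn n) 𝓘(ℂ, Cn n) D.proj (D.map z) (D.diag v)) = _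
  rw [hd]
  refine (hF _ _ (D.proj_map z) _).trans ?_
  rw [hb, map_smul]
  rfl

/-- One point of each orbit suffices: the one where dπ is the identity and fibrewise injectivity
applies directly. Equivariance reaches the rest of the orbit in `exists_coverCoeff_ne_zero`. -/
theorem exists_coverForm_ne_zero (z : W n) : ∃ k : ℤ, F.coverForm ((D.map ^ k) z) ≠ 0 := by
  obtain ⟨a, ha, hd⟩ := D.exists_mfderiv_proj_eq_id (D.proj z)
  obtain ⟨k, rfl⟩ := CyclicQuotient.mk_eq_mk.1 ha.symm
  refine ⟨k, fun h => ?_⟩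
  set a := (D.map ^ k) z
  have h1 : F.toFun (D.proj a) (D.fmk b a rfl 1) = 0 := by
    ext v
    have := DFunLike.congr_fun h v
    unfold coverForm at this
    rw [hd] at this
    exact this
  have h2 := F.injective _ (h1.trans (map_zero _).symm)
  have h3 : D.fmk b a rfl 0 = 0 := by simpa using D.fmk_smul b a rfl 0 1
  rw [← h3] at h2
  exact one_ne_zero ((D.fmk_bijective b a rfl).1 h2)

/-- The coefficients of `coverForm` are holomorphic. -/
theorem differentiableAt_coverForm (z : W n) (v : Cn n) :
    DifferentiableAt ℂ
      (fun y => F.coverForm ((extChartAt 𝓘(ℂ, Cn n) z).symm y) v) z.1 := by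
  set s := (extChartAt 𝓘(ℂ, Cn n) z).symm
  set T := (extChartAt 𝓘(ℂ, Cn n) z).target
  have hT : IsOpen T := isOpen_extChartAt_target z
  have hz : z.1 ∈ T := by
    have := mem_extChartAt_target (I := 𝓘(ℂ, Cn n)) z
    rwa [extChartAt_punctured] at this
  have hs : ContMDiffOn 𝓘(ℂ, Cn n) 𝓘(ℂ, Cn n) ω s T := contMDiffOn_extChartAt_symm z
  have hu : ContMDiffOn 𝓘(ℂ, Cn n) 𝓘(ℂ, Cn n) ω (D.proj ∘ s) T :=
    D.contMDiff_proj.comp_contMDiffOn hs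
  have hl : MDifferentiableAt 𝓘(ℂ, Cn n) (𝓘(ℂ, Cn n).prod 𝓘(ℂ, ℂ))
      (fun y => D.lmk b (s y) 1) z.1 := by
    have h1 : ContMDiff (𝓘(ℂ, Cn n).prod 𝓘(ℂ, ℂ)) (𝓘(ℂ, Cn n).prod 𝓘(ℂ, ℂ)) ω
        (CyclicQuotient.mk (D.bundleMap b)) :=
      CyclicQuotient.contMDiff_mk _ (D.wandering_bundleMap b) (D.contMDiff_bundleMap b)
        (D.contMDiff_bundleMap_symm b)
    have h2 : ContMDiffOn 𝓘(ℂ, Cn n) (𝓘(ℂ, Cn n).prod 𝓘(ℂ, ℂ)) ω (fun y => (s y, (1 : ℂ))) T :=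
      hs.prodMk contMDiffOn_const
    exact ((h1.comp_contMDiffOn h2).contMDiffAt (hT.mem_nhds hz)).mdifferentiableAt (by simp)
  have hϕ : MDifferentiableAt 𝓘(ℂ, Cn n) (𝓘(ℂ, Cn n).prod 𝓘(ℂ, Cn n →L[ℂ] ℂ))
      (fun y => (TotalSpace.mk' (Cn n →L[ℂ] ℂ) (E := D.Cotangent) (D.proj (s y))
        (F.toFun (D.proj (s y)) (D.fmk b (s y) rfl 1)))) z.1 :=
    (F.holomorphic _).comp z.1 hl
  have hv : MDifferentiableAt 𝓘(ℂ, Cn n) (𝓘(ℂ, Cn n).prod 𝓘(ℂ, Cn n))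
      (fun y => (TotalSpace.mk' (Cn n) (E := TangentSpace 𝓘(ℂ, Cn n)) (D.proj (s y))
        (mfderiv 𝓘(ℂ, Cn n) 𝓘(ℂ, Cn n) (D.proj ∘ s) y v))) z.1 := by
    have h1 := hu.contMDiffOn_tangentMapWithin (m := 1) (by simp) hT.uniqueMDiffOn
    have h2 : ContMDiff 𝓘(ℂ, Cn n) (𝓘(ℂ, Cn n).prod 𝓘(ℂ, Cn n)) 1
        (fun y => (⟨y, v⟩ : TangentBundle 𝓘(ℂ, Cn n) (Cn n))) :=
      contMDiff_vectorSpace_iff_contDiff.2 contDiff_const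
    have h3 : ContMDiffOn 𝓘(ℂ, Cn n) (𝓘(ℂ, Cn n).prod 𝓘(ℂ, Cn n)) 1 _ T :=
      h1.comp h2.contMDiffOn (fun y hy => hy)
    refine ((h3.contMDiffAt (hT.mem_nhds hz)).mdifferentiableAt one_ne_zero).congr_of_eventuallyEq ?_
    filter_upwards [hT.mem_nhds hz] with y hy
    simp only [Function.comp_apply, tangentMapWithin, mfderivWithin_of_isOpen hT hy]
  -- The covector of `[s y, 1]` and the image of the constant field `v` are holomorphic along π ∘ s;
  -- their pairing is the required coefficient.
  have h := hϕ.clm_bundle_apply (E₂ := Bundle.Trivial D.HopfManifold ℂ) hv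
  rw [mdifferentiableAt_totalSpace] at h
  have h' := h.2
  rw [mdifferentiableAt_iff_differentiableAt] at h'
  refine h'.congr_of_eventuallyEq ?_
  filter_upwards [hT.mem_nhds hz] with y hy
  have hd : (mfderiv 𝓘(ℂ, Cn n) 𝓘(ℂ, Cn n) (D.proj ∘ s) y v : Cn n)
      = mfderiv 𝓘(ℂ, Cn n) 𝓘(ℂ, Cn n) D.proj (s y) v := by
    rw [mfderiv_comp y (D.mdifferentiable_proj _)
      ((hs.contMDiffAt (hT.mem_nhds hy)).mdifferentiableAt (by simp)),
      mfderiv_extChartAt_symm_punctured z hy]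
    rfl
  change (F.toFun (D.proj (s y)) (D.fmk b (s y) rfl 1) : Cn n →L[ℂ] ℂ)
    (mfderiv 𝓘(ℂ, Cn n) 𝓘(ℂ, Cn n) D.proj (s y) v) = _
  rw [← hd]
  rfl

/-- The coefficient of `dzᵢ` in `coverForm`, extended by zero to the origin. -/
def coverCoeff (i : Fin n) (y : Cn n) : ℂ :=
  open Classical in if h : y ∈ W n then F.coverForm ⟨y, h⟩ (Pi.single i 1) else 0

theorem coverCoeff_coe (i : Fin n) (z : W n) : F.coverCoeff i z.1 = F.coverForm z (Pi.single i 1) :=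
  dif_pos z.2

theorem coverForm_eq_sum (z : W n) : F.coverForm z = ∑ i, F.coverCoeff i z.1 • dz i := by
  ext v
  conv_lhs => rw [← Finset.univ_sum_single v, map_sum]
  rw [sum_apply]
  refine Finset.sum_congr rfl fun i _ => ?_
  have : (Pi.single i (v i) : Cn n) = v i • (Pi.single i (1 : ℂ) : Cn n) := by
    rw [← Pi.single_smul', smul_eq_mul, mul_one]
  rw [this, map_smul, coverCoeff_coe, smul_eq_mul, mul_comm]
  rfl

theorem differentiableOn_coverCoeff (i : Fin n) : DifferentiableOn ℂ (F.coverCoeff i) {0}ᶜ := by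
  intro y hy
  refine DifferentiableAt.differentiableWithinAt ?_
  set z : W n := ⟨y, hy⟩
  refine (F.differentiableAt_coverForm z (Pi.single i 1)).congr_of_eventuallyEq ?_
  have hT : (extChartAt 𝓘(ℂ, Cn n) z).target ∈ 𝓝 z.1 := by
    have := extChartAt_target_mem_nhds (I := 𝓘(ℂ, Cn n)) z
    rwa [extChartAt_punctured] at this
  filter_upwards [hT] with w hw
  rw [← coverCoeff_coe, coe_extChartAt_symm_punctured z hw]

/-- The extra factor μᵢ⁻¹ compensates for f* dzᵢ = μᵢ dzᵢ. -/
theorem coverCoeff_scale (i : Fin n) {y : Cn n} (hy : y ≠ 0) :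
    F.coverCoeff i (D.mu * y) = (D.mu i)⁻¹ * (b : ℂ)⁻¹ * F.coverCoeff i y := by
  have h := F.coverForm_map ⟨y, hy⟩ (Pi.single i 1)
  have h1 : D.diag (Pi.single i 1) = D.mu i • (Pi.single i (1 : ℂ) : Cn n) := by
    ext j
    rcases eq_or_ne j i with rfl | hj
    · simp [diag_apply]
    · simp [diag_apply, hj]
  rw [h1, map_smul, ← coverCoeff_coe, ← coverCoeff_coe, smul_eq_mul] at h
  have h2 : (D.map ⟨y, hy⟩).1 = D.mu * y := rfl
  rw [h2] at h
  rw [mul_assoc, ← h, inv_mul_cancel_left₀ (D.mu_ne_zero i)]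

theorem exists_coverCoeff_ne_zero {y : Cn n} (hy : y ≠ 0) : ∃ i, F.coverCoeff i y ≠ 0 := by
  by_contra! h
  have hstep : ∀ (z : W n) (i : Fin n), F.coverCoeff i (D.map z).1 = 0 ↔ F.coverCoeff i z.1 = 0 := by
    intro z i
    have : (D.map z).1 = D.mu * z.1 := rfl
    rw [this, F.coverCoeff_scale i z.2]
    simp [D.mu_ne_zero i]
  have hall : ∀ (k : ℤ) (z : W n) (i : Fin n),
      F.coverCoeff i ((D.map ^ k) z).1 = 0 ↔ F.coverCoeff i z.1 = 0 := by
    intro k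
    induction k with
    | zero => simp
    | succ k ih =>
      intro z i
      rw [zpow_add_one, Homeomorph.mul_apply, ih, hstep]
    | pred k ih =>
      intro z i
      rw [zpow_sub_one, Homeomorph.mul_apply, ih, ← hstep, ← Homeomorph.mul_apply,
        mul_inv_cancel, Homeomorph.one_apply]
  obtain ⟨k, hk⟩ := F.exists_coverForm_ne_zero ⟨y, hy⟩
  refine hk ?_
  rw [coverForm_eq_sum]
  exact Finset.sum_eq_zero fun i _ => by
    rw [(hall k ⟨y, hy⟩ i).2 (h i)]; exact zero_smul ℂ (dz i)

/-- The fibre of `L_b` is the line spanned by `[z, 1]`, so the common kernel is the kernel of a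
single covector. -/
theorem isInducedBy_iff (η : Cn n → (Cn n →L[ℂ] ℂ)) :
    F.IsInducedBy η ↔ ∀ z : W n, LinearMap.ker (F.coverForm z).toLinearMap
      = LinearMap.ker (η z.1).toLinearMap := by
  have key : ∀ z : W n, (F.hyperplane (D.proj z)).comap
      (mfderiv 𝓘(ℂ, Cn n) 𝓘(ℂ, Cn n) D.proj z).toLinearMap
        = LinearMap.ker (F.coverForm z).toLinearMap := by
    intro z
    ext v
    simp only [hyperplane, Submodule.mem_comap, Submodule.mem_iInf, LinearMap.mem_ker]
    constructor
    · intro h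
      exact h (D.fmk b z rfl 1)
    · intro h l
      obtain ⟨c, rfl⟩ := (D.fmk_bijective b z rfl).2 l
      rw [← mul_one c, D.fmk_smul, map_smul]
      have h' : F.toFun (D.proj z) (D.fmk b z rfl 1)
        (mfderiv 𝓘(ℂ, Cn n) 𝓘(ℂ, Cn n) D.proj z v) = 0 := h
      change c • F.toFun (D.proj z) (D.fmk b z rfl 1)
        (mfderiv 𝓘(ℂ, Cn n) 𝓘(ℂ, Cn n) D.proj z v) = 0
      rw [h', smul_zero]
  exact forall_congr' fun z => ⟨fun h => (key z).symm.trans h, fun h => (key z).trans h⟩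

end Distribution
end DiagonalContraction
end Hopf

end

/-! ### Weights of the terms of the form, and the three cases. -/

noncomputable section

namespace Hopf

open MvPolynomial

variable {n : ℕ}

theorem isHomogeneous_of_degree_eq {Q : MvPolynomial (Fin n) ℂ} {p : ℕ}
    (h : ∀ d ∈ Q.support, d.degree = p) : Q.IsHomogeneous p := fun d hd =>
  (DFunLike.congr_fun Finsupp.degree_eq_weight_one d).symm.trans (h d (mem_support_iff.2 hd))

theorem eval_smul_of_isHomogeneous {Q : MvPolynomial (Fin n) ℂ} {p : ℕ}
    (hQ : Q.IsHomogeneous p) (c : ℂ) (z : Cn n) : eval (c • z) Q = c ^ p * eval z Q := by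
  rw [eval_eq', eval_eq', Finset.mul_sum]
  refine Finset.sum_congr rfl fun d hd => ?_
  have hdp : ∑ i, d i = p := by
    rw [← Finsupp.degree_eq_sum]
    exact (DFunLike.congr_fun Finsupp.degree_eq_weight_one d).trans (hQ (mem_support_iff.1 hd))
  simp only [Pi.smul_apply, smul_eq_mul, mul_pow, Finset.prod_mul_distrib,
    Finset.prod_pow_eq_pow_sum, hdp]
  ring

/-- A homogeneous polynomial of positive degree has a non-trivial zero on every plane. -/
theorem exists_eval_eq_zero_of_isHomogeneous {Q : MvPolynomial (Fin n) ℂ} {p : ℕ}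
    (hQ : Q.IsHomogeneous p) (hp : p ≠ 0) (u v : Cn n) :
    ∃ s t : ℂ, (s ≠ 0 ∨ t ≠ 0) ∧ eval (s • u + t • v) Q = 0 := by
  by_contra! h
  -- Without zeros, Q is constant on affine lines by algebraic closedness. Hence Q(u + v) = Q(u +
  -- v/2) and Q(u + v) = Q(v + 2u) = 2^p Q(u + v/2), so 2^p = 1.
  have hconst : ∀ u v : Cn n, (∀ t : ℂ, eval (u + t • v) Q ≠ 0) →
      ∀ t t' : ℂ, eval (u + t • v) Q = eval (u + t' • v) Q := by
    intro u v huv t t'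
    set q : Polynomial ℂ := aeval (fun i => Polynomial.C (u i) + Polynomial.X * Polynomial.C (v i)) Q
    have hq : ∀ t, q.eval t = eval (u + t • v) Q := by
      intro t
      rw [← Polynomial.coe_aeval_eq_eval, ← AlgHom.comp_apply, comp_aeval,
        ← coe_aeval_eq_eval, RingHom.coe_coe]
      congr 2
      ext i
      simp
      ring
    have hdeg : q.degree = 0 := by
      by_contra hd
      obtain ⟨t, ht⟩ := IsAlgClosed.exists_root q hd
      exact huv t ((hq t).symm.trans ht)
    rw [← hq, ← hq, Polynomial.eq_C_of_degree_eq_zero hdeg, Polynomial.eval_C, Polynomial.eval_C]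
  have h1 := hconst u v (fun t => by simpa using h 1 t (Or.inl one_ne_zero)) 1 2⁻¹
  have h2 := hconst v u (fun t => by
    rw [add_comm]; simpa using h t 1 (Or.inr one_ne_zero)) 1 2
  have h3 : v + (2 : ℂ) • u = (2 : ℂ) • (u + (2⁻¹ : ℂ) • v) := by
    ext i; simp [mul_add]; ring
  rw [h3, eval_smul_of_isHomogeneous hQ, ← h1, one_smul, one_smul, add_comm v u] at h2
  have h5 : eval (u + v) Q ≠ 0 := by simpa using h 1 1 (Or.inl one_ne_zero)
  have h6 : (2 : ℂ) ^ p = 1 := (mul_left_eq_self₀.1 h2.symm).resolve_right h5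
  have h7 := congrArg norm h6
  rw [norm_pow, norm_one, Complex.norm_ofNat] at h7
  exact absurd h7 (one_lt_pow₀ one_lt_two hp).ne'

theorem exists_mem_support_of_eval_ne_zero {z : Cn n} {Q : MvPolynomial (Fin n) ℂ}
    (h : eval z Q ≠ 0) : ∃ d ∈ Q.support, ∀ i, z i = 0 → d i = 0 := by
  rw [eval_eq'] at h
  obtain ⟨d, hd, hne⟩ := Finset.exists_ne_zero_of_sum_ne_zero h
  refine ⟨d, hd, fun i hi => ?_⟩
  by_contra hdi
  refine hne (mul_eq_zero_of_right _ (Finset.prod_eq_zero (Finset.mem_univ i) ?_))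
  rw [hi, zero_pow hdi]

theorem eval_eq_coeff_zero {Q : MvPolynomial (Fin n) ℂ} (h : ∀ d ∈ Q.support, d = 0) (z : Cn n) :
    eval z Q = coeff 0 Q := by
  have : Q = C (coeff 0 Q) := by
    ext d
    rw [coeff_C]
    split_ifs with hd
    · rw [hd]
    · by_contra hne
      exact hd (h d (mem_support_iff.2 hne)).symm
  conv_lhs => rw [this, eval_C]

section Weights

variable {P : Fin n → MvPolynomial (Fin n) ℂ} {β : Fin n → Fin n} {l : Fin n →₀ ℕ}

/-- If all terms of the form `∑ Pᵢ dzᵢ` have the weight `l` with respect to the grading given by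
`β`, then the weight restricts the terms which do not vanish on a coordinate axis. -/
theorem exists_eq_single_add_single (hP : ∀ z ≠ 0, ∃ i, eval z (P i) ≠ 0)
    (hl : ∀ i, ∀ d ∈ (P i).support, Finsupp.mapDomain β (d + Finsupp.single i 1) = l) (k : Fin n) :
    ∃ (p : ℕ) (i : Fin n), l = Finsupp.single (β k) p + Finsupp.single (β i) 1 := by
  -- On the k-th axis only pure powers of z_k survive, so some term z_k^p dzᵢ occurs.
  obtain ⟨i, hi⟩ := hP (Pi.single k 1) (by simp)
  obtain ⟨d, hd, hdz⟩ := exists_mem_support_of_eval_ne_zero hi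
  refine ⟨d k, i, ?_⟩
  have : d = Finsupp.single k (d k) := by
    ext j
    rcases eq_or_ne j k with rfl | hj
    · simp
    · rw [hdz j (by simp [hj]), Finsupp.single_eq_of_ne hj]
  rw [← hl i d hd, Finsupp.mapDomain_add, Finsupp.mapDomain_single]
  conv_lhs => rw [this, Finsupp.mapDomain_single]

theorem eq_single_of_apply_eq_zero (hP : ∀ z ≠ 0, ∃ i, eval z (P i) ≠ 0)
    (hl : ∀ i, ∀ d ∈ (P i).support, Finsupp.mapDomain β (d + Finsupp.single i 1) = l) {k : Fin n}
    (hk : l (β k) = 0) : ∃ i, l = Finsupp.single (β i) 1 := by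
  obtain ⟨p, i, h⟩ := exists_eq_single_add_single hP hl k
  have h1 : p = 0 := by
    rw [h, Finsupp.add_apply, Finsupp.single_eq_same] at hk
    omega
  exact ⟨i, by simpa [h1] using h⟩

theorem degree_add_one_eq
    (hl : ∀ i, ∀ d ∈ (P i).support, Finsupp.mapDomain β (d + Finsupp.single i 1) = l) {i : Fin n}
    {d : Fin n →₀ ℕ} (hd : d ∈ (P i).support) : d.degree + 1 = l.degree := by
  rw [← hl i d hd, Finsupp.degree_mapDomain]
  simp

/-- One axis shows that l involves at most two indices; a third index is then absent from l, and its
axis leaves only a constant coefficient. For n = 2 this fails: z₁dz₂ + c z₂dz₁ with c ≠ 0 has no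
zero on W. -/
theorem exists_eq_single_of_eq_id (hn : 3 ≤ n) (hP : ∀ z ≠ 0, ∃ i, eval z (P i) ≠ 0)
    (hl : ∀ i, ∀ d ∈ (P i).support, Finsupp.mapDomain id (d + Finsupp.single i 1) = l) :
    ∃ i, l = Finsupp.single i 1 := by
  obtain ⟨p, i, h⟩ := exists_eq_single_add_single hP hl ⟨0, by omega⟩
  set o : Fin n := ⟨0, by omega⟩
  obtain ⟨k, hk⟩ : ∃ k, k ∉ ({o, i} : Finset (Fin n)) := by
    by_contra! hall
    have h1 := Finset.card_le_card fun (k : Fin n) (_ : k ∈ Finset.univ) => hall k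
    have h2 := Finset.card_le_two (a := o) (b := i)
    rw [Finset.card_univ, Fintype.card_fin] at h1
    omega
  simp only [Finset.mem_insert, Finset.mem_singleton, not_or] at hk
  refine eq_single_of_apply_eq_zero hP hl (k := k) ?_
  rw [h]
  simp [hk.1, hk.2]

theorem exists_eq_single_of_block {r : ℕ} (hr : 2 ≤ r) (hrn : r + 1 ≤ n)
    (hβ : ∀ i : Fin n, i.val < r → (β i).val = 0) (hβ' : ∀ i : Fin n, r ≤ i.val → β i = i)
    (hP : ∀ z ≠ 0, ∃ i, eval z (P i) ≠ 0)
    (hl : ∀ i, ∀ d ∈ (P i).support, Finsupp.mapDomain β (d + Finsupp.single i 1) = l) :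
    ∃ i, l = Finsupp.single (β i) 1 := by
  set o : Fin n := ⟨0, by omega⟩
  set o' : Fin n := ⟨1, by omega⟩
  set k : Fin n := ⟨n - 1, by omega⟩ with hkdef
  have hoo : o ≠ o' := by simp [o, o']
  have hko : k ≠ o := by simp [hkdef, o]; omega
  have hβo : β o = o := Fin.ext (hβ o (by simp [o]; omega))
  have hβo' : β o' = o := Fin.ext (hβ o' (by simp [o']; omega))
  have hβk : β k = k := hβ' k (by simp [hkdef]; omega)
  have hβi : ∀ i, β i = k → i = k := by
    intro i hi
    rcases lt_or_ge i.val r with h | h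
    · exact absurd (hi.symm.trans (Fin.ext (hβ i h) : β i = o)) hko
    · rw [← hi, hβ' i h]
  obtain ⟨p, i, h⟩ := exists_eq_single_add_single hP hl o
  rw [hβo] at h
  rcases eq_or_ne p 0 with rfl | hp
  · exact ⟨i, by simpa using h⟩
  by_cases hik : β i = k
  swap
  · refine eq_single_of_apply_eq_zero hP hl (k := k) ?_
    rw [hβk, h]
    simp [hko, Ne.symm hik]
  -- There remains l = p·o + k with p ≥ 1. On the plane of the axes `o` and `o'`, both in the block,
  -- z_k = 0, so the k-component of l can only come from dz_k. Only `P k` can then be nonzero there,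
  -- yet it is homogeneous of degree p and has a zero on this plane.
  exfalso
  rw [hik] at h
  have hhom : (P k).IsHomogeneous p := by
    refine isHomogeneous_of_degree_eq fun d hd => ?_
    have := degree_add_one_eq hl hd
    rw [h] at this
    simpa using this
  obtain ⟨s, t, hst, h0⟩ := exists_eval_eq_zero_of_isHomogeneous hhom hp (Pi.single o 1)
    (Pi.single o' 1)
  obtain ⟨j, hj⟩ := hP (s • Pi.single o 1 + t • Pi.single o' 1) (by
    intro hz
    have e1 := congrFun hz o
    have e2 := congrFun hz o'
    simp [hoo, hoo.symm] at e1 e2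
    simp [e1, e2] at hst)
  obtain ⟨d, hd, hdz⟩ := exists_mem_support_of_eval_ne_zero hj
  have hdo : Finsupp.mapDomain β d k = 0 := by
    rw [Finsupp.mapDomain, Finsupp.sum_apply]
    refine Finset.sum_eq_zero fun m _ => ?_
    by_cases hm : m = o ∨ m = o'
    · refine Finsupp.single_eq_of_ne ?_
      rcases hm with rfl | rfl
      · rw [hβo]; exact hko
      · rw [hβo']; exact hko
    · push Not at hm
      rw [hdz m (by simp [hm.1, hm.2])]
      simp
  have hlk := DFunLike.congr_fun (hl j d hd) k
  rw [Finsupp.mapDomain_add, Finsupp.mapDomain_single, Finsupp.add_apply, hdo, h,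
    Finsupp.add_apply, Finsupp.single_eq_same, zero_add] at hlk
  have hjk : j = k := by
    refine hβi j ?_
    by_contra hne
    rw [Finsupp.single_eq_of_ne (Ne.symm hne)] at hlk
    omega
  rw [hjk] at hj
  exact hj h0

end Weights

namespace DiagonalContraction

variable {D : DiagonalContraction n}

/-- Cancelling the common factor with exponents min(d, d') leaves a relation between products over
complementary subsets of `S`. -/
theorem NoRelation.eq_of_prod_eq {S : Finset (Fin n)} (h : D.NoRelation S) {d d' : Fin n →₀ ℕ}
    (hd : ∀ i ∉ S, d i = 0) (hd' : ∀ i ∉ S, d' i = 0)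
    (hdd : (d.prod fun i k => D.mu i ^ k) = d'.prod fun i k => D.mu i ^ k) : d = d' := by
  -- Subtraction is truncated, so this is |d i - d' i|.
  set e : Fin n → ℕ := fun i => (d i - d' i) + (d' i - d i)
  have hsplit : ∀ a : Fin n →₀ ℕ, ∀ p : Fin n → Prop, ∀ [DecidablePred p], (∀ i ∉ S, a i = 0) →
      (∀ i ∈ S, a i = min (d i) (d' i) + if p i then e i else 0) →
      (a.prod fun i k => D.mu i ^ k) = (∏ i ∈ S, D.mu i ^ min (d i) (d' i)) *
        ∏ i ∈ S.filter p, D.mu i ^ e i := by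
    intro a p _ ha hap
    rw [Finsupp.prod_of_support_subset a (s := S) _ _ (by simp), Finset.prod_filter,
      ← Finset.prod_mul_distrib]
    · refine Finset.prod_congr rfl fun i hi => ?_
      rw [hap i hi, pow_add]
      split_ifs <;> simp
    · intro i hi
      by_contra hS
      exact Finsupp.mem_support_iff.1 hi (ha i hS)
  have h1 := hsplit d (fun i => d' i ≤ d i) hd (fun i _ => by simp only [e]; split_ifs <;> omega)
  have h2 := hsplit d' (fun i => ¬ d' i ≤ d i) hd'
    (fun i _ => by simp only [e]; split_ifs <;> omega)
  rw [h1, h2] at hdd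
  have hne : ∏ i ∈ S, D.mu i ^ min (d i) (d' i) ≠ 0 :=
    Finset.prod_ne_zero_iff.2 fun i _ => pow_ne_zero _ (D.mu_ne_zero i)
  have h3 := h _ _ e (Finset.disjoint_filter_filter_not S S _) (Finset.filter_union_filter_not_eq _ S)
    (mul_left_cancel₀ hne hdd)
  ext i
  by_cases hi : i ∈ S
  · have := h3 i hi
    simp only [e] at this
    omega
  · rw [hd i hi, hd' i hi]

namespace Distribution

variable {b : ℂˣ} (F : D.Distribution b)

/-- A distribution with conormal bundle `L_b` is induced by a polynomial form without zeros on `W`,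
all of whose terms are multiplied by `b⁻¹` under `f`. -/
theorem exists_polynomial_form (hn : 2 ≤ n) :
    ∃ P : Fin n → MvPolynomial (Fin n) ℂ, (∀ z ≠ 0, ∃ i, eval z (P i) ≠ 0) ∧
      (∀ i, ∀ d ∈ (P i).support, ((d + Finsupp.single i 1).prod fun i k => D.mu i ^ k)
        = (b : ℂ)⁻¹) ∧
      F.IsInducedBy (fun z => ∑ i, eval z (P i) • dz i) := by
  choose P hP hc using fun i => exists_mvPolynomial_of_eigenfunction hn D.mu_ne_zero
    D.norm_mu_lt_one (F.differentiableOn_coverCoeff i)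
    (mul_ne_zero (inv_ne_zero (D.mu_ne_zero i)) (inv_ne_zero b.ne_zero))
    (fun z hz => F.coverCoeff_scale i hz)
  refine ⟨P, fun z hz => ?_, fun i d hd => ?_, ?_⟩
  · obtain ⟨i, hi⟩ := F.exists_coverCoeff_ne_zero hz
    exact ⟨i, by rwa [hP i z hz]⟩
  · rw [Finsupp.prod_add_index' (by simp) (fun i => pow_add (D.mu i)), hc i d hd,
      Finsupp.prod_single_index (by simp), pow_one]
    field_simp [D.mu_ne_zero i]
  · rw [isInducedBy_iff]
    intro z
    have : F.coverForm z = ∑ i, eval z.1 (P i) • dz i := by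
      rw [coverForm_eq_sum]
      exact Finset.sum_congr rfl fun i _ => by rw [hP i z.1 z.2]
    rw [this]

/-- If all terms of an inducing form have a weight concentrated in one index, then the form is
constant. -/
theorem exists_constant_form (hn : 3 ≤ n) {S : Finset (Fin n)} (hS : D.NoRelation S)
    {β : Fin n → Fin n} (hβS : ∀ i, β i ∈ S) (hβ : ∀ i, D.mu (β i) = D.mu i)
    (hw : ∀ (P : Fin n → MvPolynomial (Fin n) ℂ) (l : Fin n →₀ ℕ),
      (∀ z ≠ 0, ∃ i, eval z (P i) ≠ 0) →
      (∀ i, ∀ d ∈ (P i).support, Finsupp.mapDomain β (d + Finsupp.single i 1) = l) →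
      ∃ i, l = Finsupp.single (β i) 1) :
    ∃ (j : Fin n) (c : Fin n → ℂ), (b : ℂ)⁻¹ = D.mu (β j) ∧ c ≠ 0 ∧ (∀ i, c i ≠ 0 → β i = β j) ∧
      F.IsInducedBy (fun _ => ∑ i, c i • dz i) := by
  obtain ⟨P, hP, hPw, hF⟩ := F.exists_polynomial_form (by omega)
  have hprod : ∀ d : Fin n →₀ ℕ, ((Finsupp.mapDomain β d).prod fun i k => D.mu i ^ k)
      = d.prod fun i k => D.mu i ^ k := by
    intro d
    rw [Finsupp.prod_mapDomain_index (by simp) (fun i => pow_add (D.mu i))]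
    simp only [hβ]
  have hsupp : ∀ d : Fin n →₀ ℕ, ∀ i ∉ S, Finsupp.mapDomain β d i = 0 := by
    intro d i hi
    refine Finsupp.mapDomain_of_notMem_range d i ?_
    rintro ⟨j, rfl⟩
    exact hi (hβS j)
  obtain ⟨i₀, hi₀⟩ := hP 1 (fun h => by simpa using congrFun h ⟨0, by omega⟩)
  obtain ⟨d₀, hd₀, -⟩ := exists_mem_support_of_eval_ne_zero hi₀
  -- The weight of an arbitrary term; all terms share it, because they have the same eigenvalue b⁻¹
  -- and the multipliers indexed by `S` have no relation.
  set l := Finsupp.mapDomain β (d₀ + Finsupp.single i₀ 1) with hldef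
  have hl : ∀ i, ∀ d ∈ (P i).support, Finsupp.mapDomain β (d + Finsupp.single i 1) = l := by
    intro i d hd
    refine hS.eq_of_prod_eq (hsupp _) (hsupp _) ?_
    rw [hprod, hprod, hPw i d hd, hPw i₀ d₀ hd₀]
  obtain ⟨j, hj⟩ := hw P l hP hl
  have hzero : ∀ i, ∀ d ∈ (P i).support, d = 0 := by
    intro i d hd
    have := degree_add_one_eq hl hd
    rw [hj, Finsupp.degree_single] at this
    exact Finsupp.degree_eq_zero_iff d |>.1 (by omega)
  have hconst : ∀ i z, eval z (P i) = coeff 0 (P i) := fun i z => eval_eq_coeff_zero (hzero i) z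
  refine ⟨j, fun i => coeff 0 (P i), ?_, ?_, ?_, ?_⟩
  · rw [← hPw i₀ d₀ hd₀, ← hprod, ← hldef, hj, Finsupp.prod_single_index (by simp), pow_one]
  · intro h
    rw [hconst] at hi₀
    exact hi₀ (congrFun h i₀)
  · intro i hi
    have h1 := hl i 0 (mem_support_iff.2 hi)
    rw [zero_add, Finsupp.mapDomain_single, hj] at h1
    exact (Finsupp.single_left_inj one_ne_zero).1 h1
  · simpa only [hconst] using hF

/-- Every term has eigenvalue μ^(deg d + 1), the extra 1 coming from dzᵢ, and 0 < |μ| < 1 makes the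
exponent unique. -/
theorem classical_case (hn : 3 ≤ n) {μ : ℂ} (hμ : D.IsClassical μ) :
    ∃ m : ℕ, 1 ≤ m ∧ (b : ℂ)⁻¹ = μ ^ m ∧
      ∃ g : Fin n → MvPolynomial (Fin n) ℂ,
        (∀ i, (g i).IsHomogeneous (m - 1)) ∧
        {z : Fin n → ℂ | ∀ i, eval z (g i) = 0} ⊆ {0} ∧
        (2 ≤ m → {z : Fin n → ℂ | ∀ i, eval z (g i) = 0} = {0}) ∧
        F.IsInducedBy (fun z => ∑ i, eval z (g i) • dz i) := by
  obtain ⟨P, hP, hPw, hF⟩ := F.exists_polynomial_form (by omega)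
  obtain ⟨i₀, hi₀⟩ := hP 1 (fun h => by simpa using congrFun h ⟨0, by omega⟩)
  obtain ⟨d₀, hd₀, -⟩ := exists_mem_support_of_eval_ne_zero hi₀
  have hpow : ∀ i, ∀ d ∈ (P i).support, (b : ℂ)⁻¹ = μ ^ (d.degree + 1) := by
    intro i d hd
    rw [← hPw i d hd]
    simp only [hμ _]
    rw [Finsupp.prod, Finset.prod_pow_eq_pow_sum]
    congr 1
    change (d + Finsupp.single i 1).degree = _
    simp
  have hμ0 : 0 < ‖μ‖ := norm_pos_iff.2 (hμ i₀ ▸ D.mu_ne_zero i₀)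
  have hμ1 : ‖μ‖ < 1 := hμ i₀ ▸ D.norm_mu_lt_one i₀
  have hhom : ∀ i, (P i).IsHomogeneous (d₀.degree + 1 - 1) := by
    refine fun i => isHomogeneous_of_degree_eq fun d hd => ?_
    have h1 := congrArg norm ((hpow i d hd).symm.trans (hpow i₀ d₀ hd₀))
    rw [norm_pow, norm_pow] at h1
    have h2 := pow_right_injective₀ hμ0 hμ1.ne h1
    omega
  have hsub : {z : Fin n → ℂ | ∀ i, eval z (P i) = 0} ⊆ {0} := by
    intro z hz
    by_contra hz0
    obtain ⟨i, hi⟩ := hP z hz0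
    exact hi (hz i)
  refine ⟨d₀.degree + 1, by omega, hpow i₀ d₀ hd₀, P, hhom, hsub, fun hm => ?_, hF⟩
  refine hsub.antisymm ?_
  rintro _ rfl i
  rw [← zero_smul ℂ (0 : Cn n), eval_smul_of_isHomogeneous (hhom i), zero_pow (by omega), zero_mul]

theorem generic_case (hn : 3 ≤ n) (hD : D.IsGeneric) :
    ∃ j : Fin n, (b : ℂ)⁻¹ = D.mu j ∧ F.IsInducedBy (fun _ => dz j) := by
  obtain ⟨j, c, hb, hc, hcj, hF⟩ := F.exists_constant_form hn hD.2 (β := id) (by simp)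
    (fun _ => rfl) (fun P l hP hl => exists_eq_single_of_eq_id hn hP hl)
  refine ⟨j, hb, ?_⟩
  have hcj' : ∀ i, i ≠ j → c i = 0 := fun i hi => by
    by_contra h
    exact hi (hcj i h)
  have hj : c j ≠ 0 := fun h => hc <| funext fun i => by
    rcases eq_or_ne i j with rfl | hi
    · exact h
    · exact hcj' i hi
  have hsum : ∑ i, c i • (dz i : Cn n →L[ℂ] ℂ) = c j • dz j :=
    Finset.sum_eq_single j (fun i _ hi => by rw [hcj' i hi]; exact zero_smul ℂ (dz i)) (by simp)
  rw [isInducedBy_iff] at hF ⊢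
  intro z
  rw [hF z, hsum]
  ext v
  simp [hj]

theorem intermediary_case (hn : 3 ≤ n) {r : ℕ} (hD : D.IsIntermediary r) :
    (∃ j ∈ intermediaryIndices n r, (b : ℂ)⁻¹ = D.mu j) ∧
      ∃ c : Fin n → ℂ, c ≠ 0 ∧ F.IsInducedBy (fun _ => ∑ i, c i • dz i) := by
  obtain ⟨hr, hrn, hmu, hS⟩ := hD
  -- The r equal multipliers are merged into the representative 0, so that `NoRelation` applies to
  -- the merged weights.
  set β : Fin n → Fin n := fun i => if i.val < r then ⟨0, by omega⟩ else i with hβ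
  have hβS : ∀ i, β i ∈ intermediaryIndices n r := by
    intro i
    simp only [hβ, intermediaryIndices, Finset.mem_filter, Finset.mem_univ, true_and]
    split_ifs with h
    · exact Or.inl rfl
    · exact Or.inr (not_lt.1 h)
  obtain ⟨j, c, hb, hc, -, hF⟩ := F.exists_constant_form hn hS hβS
    (fun i => by
      simp only [hβ]
      split_ifs with h
      · exact hmu _ _ (by simp; omega) h
      · rfl)
    (fun P l hP hl => exists_eq_single_of_block hr hrn (fun i hi => by simp [hβ, hi])
      (fun i hi => by simp [hβ, not_lt.2 hi]) hP hl)
  exact ⟨⟨β j, hβS j, hb⟩, c, hc, hF⟩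

end Distribution
end DiagonalContraction
end Hopf

end

theorem theorem3 {n : ℕ} (hn : 3 ≤ n) (D : Hopf.DiagonalContraction n) (b : ℂˣ)
    (F : D.Distribution b) :
    (∀ μ : ℂ, D.IsClassical μ →
      ∃ m : ℕ, 1 ≤ m ∧ (b : ℂ)⁻¹ = μ ^ m ∧
        ∃ g : Fin n → MvPolynomial (Fin n) ℂ,
          (∀ i, (g i).IsHomogeneous (m - 1)) ∧
          {z : Fin n → ℂ | ∀ i, MvPolynomial.eval z (g i) = 0} ⊆ {0} ∧
          (2 ≤ m → {z : Fin n → ℂ | ∀ i, MvPolynomial.eval z (g i) = 0} = {0}) ∧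
          F.IsInducedBy (fun z => ∑ i, MvPolynomial.eval z (g i) • Hopf.dz i)) ∧
    (D.IsGeneric →
      ∃ j : Fin n, (b : ℂ)⁻¹ = D.mu j ∧ F.IsInducedBy (fun _ => Hopf.dz j)) ∧
    (∀ r : ℕ, D.IsIntermediary r →
      (∃ j ∈ Hopf.DiagonalContraction.intermediaryIndices n r, (b : ℂ)⁻¹ = D.mu j) ∧
        ∃ c : Fin n → ℂ, c ≠ 0 ∧ F.IsInducedBy (fun _ => ∑ i, c i • Hopf.dz i)) := by
  exact ⟨fun _ hμ => F.classical_case hn hμ, F.generic_case hn, fun _ hr => F.intermediary_case hn hr⟩
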